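/- Let $\mathbb{M}_2=\mathbb{F}_2[\tau]$, with $\tau$ in bidegree $(0,1)$, be the mod 2 motivic cohomology of a point over $\mathbb{C}$. Let $\mathcal{A}(1)$ be the $\mathbb{M}_2$-subalgebra of the $\mathbb{C}$-motivic mod 2 Steenrod algebra generated by $\mathrm{Sq}^1$ (bidegree $(1,0)$) and $\mathrm{Sq}^2$ (bidegree $(2,1)$). Its relations are $\mathrm{Sq}^1\mathrm{Sq}^1=0$, $\mathrm{Sq}^2\mathrm{Sq}^2=\tau\,\mathrm{Sq}^1\mathrm{Sq}^2\mathrm{Sq}^1$ and $\mathrm{Sq}^1\mathrm{Sq}^2\mathrm{Sq}^1\mathrm{Sq}^2=\mathrm{Sq}^2\mathrm{Sq}^1\mathrm{Sq}^2\mathrm{Sq}^1$, the element $\mathrm{Sq}^1$ is primitive, and $\Delta(\mathrm{Sq}^2)=\mathrm{Sq}^2\otimes 1+\tau\,\mathrm{Sq}^1\otimes\mathrm{Sq}^1+1\otimes\mathrm{Sq}^2$. Let $\mathrm{Stab}(\mathcal{A}(1))$ be the category whose objects are the bigraded finitely generated left $\mathcal{A}(1)$-modules that are free over $\mathbb{M}_2$,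 and whose morphisms are the bidegree-preserving $\mathcal{A}(1)$-linear maps, two maps being identified when their difference factors through a projective $\mathcal{A}(1)$-module. It carries the tensor product $\otimes=\otimes_{\mathbb{M}_2}$, with unit $\mathbb{M}_2$. A module $M$ is invertible if $M\otimes N\cong\mathbb{M}_2$ in $\mathrm{Stab}(\mathcal{A}(1))$ for some object $N$, and $\mathrm{Pic}(\mathcal{A}(1))$ is the group of isomorphism classes $[M]$ of invertible objects of $\mathrm{Stab}(\mathcal{A}(1))$ under $\otimes$. Let the motivic joker $J$ be the $\mathcal{A}(1)$-module on generators $x$ in bidegree $(0,0)$ and $y$ in bidegree $(2,0)$ with relations $\mathrm{Sq}^2x=\tau y$, $\mathrm{Sq}^1\mathrm{Sq}^2\mathrm{Sq}^1x=\mathrm{Sq}^2y$ and $\mathrm{Sq}^1y=0$. Lemma. The module $J$ is invertible, and $[J]$ has infinite order in $\mathrm{Pic}(\mathcal{A}(1))$. Moreover, for every $n\ge 1$, the Margolis homologies $H(J^{\otimes n}/\tau;\mathrm{Sq}^2)$ and $H(J^{\otimes n}/\tau;Q_0)$ are each nonzero in exactly one bidegree, and these two bidegrees are different. Here $Q_0=\mathrm{Sq}^1$,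 and $H(M/\tau;a)$ denotes the annihilator of $a$ in $M/\tau$ modulo $a\cdot(M/\tau)$. -/

import Mathlib

open scoped TensorProduct Matrix

namespace MotivicA1

noncomputable section

/-! ### The ground ring, the motivic Steenrod algebra and the algebra `𝒜(1)` -/

/-- The mod 2 motivic cohomology of a point over `ℂ`: the polynomial ring `𝔽₂[τ]`. -/
abbrev M2 : Type := Polynomial (ZMod 2)

/-- The generator `τ` of `M2`, of bidegree `(0,1)`. -/
abbrev tau : M2 := Polynomial.X

/-- The defining relations of the `ℂ`-motivic mod 2 Steenrod algebra: `Sq⁰ = 1` and the motivic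
Adem relations
`Sqᵃ Sqᵇ = ∑ⱼ (b-1-j choose a-2j) τ^ε Sqᵃ⁺ᵇ⁻ʲ Sqʲ` for `0 < a < 2b`, where `ε = 1` if `a` and `b`
are even and `j` is odd, and `ε = 0` otherwise. -/
inductive SteenrodRel : FreeAlgebra M2 ℕ → FreeAlgebra M2 ℕ → Prop
  | sq_zero : SteenrodRel (FreeAlgebra.ι M2 0) 1
  | adem (a b : ℕ) (ha : 0 < a) (hab : a < 2 * b) :
      SteenrodRel (FreeAlgebra.ι M2 a * FreeAlgebra.ι M2 b)
        (∑ j ∈ Finset.range (a / 2 + 1),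
          (((b - 1 - j).choose (a - 2 * j) : M2) *
              (if Even a ∧ Even b ∧ Odd j then tau else 1)) •
            (FreeAlgebra.ι M2 (a + b - j) * FreeAlgebra.ι M2 j))

/-- The `ℂ`-motivic mod 2 Steenrod algebra. -/
abbrev Steenrod : Type := RingQuot SteenrodRel

/-- The Steenrod square `Sqᵏ`, of bidegree `(k, ⌊k/2⌋)`. -/
def Steenrod.sq (k : ℕ) : Steenrod := RingQuot.mkAlgHom M2 SteenrodRel (FreeAlgebra.ι M2 k)

/-- The two generators of `𝒜(1)`. -/
inductive Gen : Type
  | one : Gen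
  | two : Gen

/-- The defining relations of `𝒜(1)`: `Sq¹Sq¹ = 0`, `Sq²Sq² = τ Sq¹Sq²Sq¹`,
`Sq¹Sq²Sq¹Sq² = Sq²Sq¹Sq²Sq¹`. -/
inductive Rel : FreeAlgebra M2 Gen → FreeAlgebra M2 Gen → Prop
  | one_one : Rel (FreeAlgebra.ι M2 .one * FreeAlgebra.ι M2 .one) 0
  | two_two : Rel (FreeAlgebra.ι M2 .two * FreeAlgebra.ι M2 .two)
      (tau • (FreeAlgebra.ι M2 .one * FreeAlgebra.ι M2 .two * FreeAlgebra.ι M2 .one))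
  | top : Rel
      (FreeAlgebra.ι M2 .one * FreeAlgebra.ι M2 .two * FreeAlgebra.ι M2 .one *
        FreeAlgebra.ι M2 .two)
      (FreeAlgebra.ι M2 .two * FreeAlgebra.ι M2 .one * FreeAlgebra.ι M2 .two *
        FreeAlgebra.ι M2 .one)

/-- The `ℂ`-motivic algebra `𝒜(1)`, presented by `Sq¹`, `Sq²` and their relations. By
`A1.toSteenrod_injective` and `A1.range_toSteenrod` it is the `M2`-subalgebra of the motivic
Steenrod algebra generated by `Sq¹` and `Sq²`. -/
def A1 : Type := RingQuot Rel

namespace A1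

instance : Ring A1 := inferInstanceAs (Ring (RingQuot Rel))

instance : Algebra M2 A1 := inferInstanceAs (Algebra M2 (RingQuot Rel))

/-- The quotient map from the free algebra. -/
def mk : FreeAlgebra M2 Gen →ₐ[M2] A1 := RingQuot.mkAlgHom M2 Rel

theorem mk_surjective : Function.Surjective mk := RingQuot.mkAlgHom_surjective M2 Rel

theorem mk_rel {x y : FreeAlgebra M2 Gen} (h : Rel x y) : mk x = mk y :=
  RingQuot.mkAlgHom_rel M2 h

/-- `Sq¹`, of bidegree `(1,0)`. -/
def sq1 : A1 := mk (FreeAlgebra.ι M2 .one)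

/-- `Sq²`, of bidegree `(2,1)`. -/
def sq2 : A1 := mk (FreeAlgebra.ι M2 .two)

theorem sq1_sq1 : sq1 * sq1 = 0 := by
  have h := mk_rel Rel.one_one
  rw [map_mul, map_zero] at h
  exact h

theorem sq2_sq2 : sq2 * sq2 = tau • (sq1 * sq2 * sq1) := by
  have h := mk_rel Rel.two_two
  simp only [map_mul, map_smul] at h
  exact h

theorem sq_top : sq1 * sq2 * sq1 * sq2 = sq2 * sq1 * sq2 * sq1 := by
  have h := mk_rel Rel.top
  simp only [map_mul] at h
  exact h

/-- The universal property of `𝒜(1)`. -/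
def lift {B : Type*} [Ring B] [Algebra M2 B] (p u : B) (h11 : p * p = 0)
    (h22 : u * u = tau • (p * u * p)) (htop : p * u * p * u = u * p * u * p) : A1 →ₐ[M2] B :=
  RingQuot.liftAlgHom M2
    ⟨FreeAlgebra.lift M2 (fun g : Gen => match g with | .one => p | .two => u), by
      intro x y h
      cases h <;> simp only [map_mul, map_smul, map_zero, FreeAlgebra.lift_ι_apply, *]⟩

section lift

variable {B : Type*} [Ring B] [Algebra M2 B] (p u : B) (h11 : p * p = 0)
    (h22 : u * u = tau • (p * u * p)) (htop : p * u * p * u = u * p * u * p)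

@[simp] theorem lift_sq1 : lift p u h11 h22 htop sq1 = p := by
  refine (RingQuot.liftAlgHom_mkAlgHom_apply M2 _ _ _).trans ?_
  simp

@[simp] theorem lift_sq2 : lift p u h11 h22 htop sq2 = u := by
  refine (RingQuot.liftAlgHom_mkAlgHom_apply M2 _ _ _).trans ?_
  simp

end lift

/-- A subalgebra of `𝒜(1)` containing `Sq¹` and `Sq²` is everything. -/
theorem subalgebra_eq_top (S : Subalgebra M2 A1) (h1 : sq1 ∈ S) (h2 : sq2 ∈ S) : S = ⊤ := by
  rw [eq_top_iff]
  rintro a -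
  obtain ⟨w, rfl⟩ := mk_surjective a
  induction w using FreeAlgebra.induction with
  | grade0 r => rw [AlgHom.commutes]; exact S.algebraMap_mem r
  | grade1 g => cases g <;> assumption
  | mul a b ha hb => rw [map_mul]; exact S.mul_mem ha hb
  | add a b ha hb => rw [map_add]; exact S.add_mem ha hb

theorem adjoin_eq_top : Algebra.adjoin M2 ({sq1, sq2} : Set A1) = ⊤ :=
  subalgebra_eq_top _ (Algebra.subset_adjoin (by simp)) (Algebra.subset_adjoin (by simp))

/-- The eight monomials that span `𝒜(1)` over `M2`. -/
def mono : Fin 8 → A1 :=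
  ![1, sq1, sq2, sq1 * sq2, sq2 * sq1, sq1 * sq2 * sq1, sq2 * sq1 * sq2, sq1 * sq2 * sq1 * sq2]

theorem span_mono : Submodule.span M2 (Set.range mono) = ⊤ := by
  set W := Submodule.span M2 (Set.range mono) with hW
  have hm : ∀ i, mono i ∈ W := fun i => Submodule.subset_span ⟨i, rfl⟩
  have e11 := sq1_sq1
  have e22 := sq2_sq2
  have et := sq_top
  have key1 : ∀ i, sq1 * mono i ∈ W := by
    intro i
    have h0 : (0 : A1) ∈ W := W.zero_mem
    fin_cases i
    · simpa [mono] using hm 1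
    · simp [mono, e11]
    · simpa [mono] using hm 3
    · simp [mono, ← mul_assoc, e11]
    · simpa [mono, mul_assoc] using hm 5
    · simp [mono, ← mul_assoc, e11]
    · simpa [mono, mul_assoc] using hm 7
    · simp [mono, ← mul_assoc, e11]
  have key2 : ∀ i, sq2 * mono i ∈ W := by
    intro i
    have h0 : (0 : A1) ∈ W := W.zero_mem
    fin_cases i
    · simpa [mono] using hm 2
    · simpa [mono] using hm 4
    · simpa [mono, e22] using W.smul_mem tau (hm 5)
    · simpa [mono, mul_assoc] using hm 6
    · simp [mono, ← mul_assoc, e22, mul_assoc _ sq1 sq1, e11]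
    · simpa [mono, ← mul_assoc, et] using hm 7
    · have : sq2 * (sq2 * sq1 * sq2) = tau • (sq1 * sq2 * (sq1 * sq1) * sq2) := by
        rw [← mul_assoc, ← mul_assoc, e22]; simp [mul_assoc]
      simp [mono, this, e11]
    · have : sq2 * (sq1 * sq2 * sq1 * sq2) = tau • (sq1 * sq2 * (sq1 * sq1) * sq2 * sq1) := by
        rw [et]
        simp only [← mul_assoc]
        rw [e22]; simp [mul_assoc]
      simp [mono, this, e11]
  have stab : ∀ g : A1, (∀ i, g * mono i ∈ W) → ∀ x ∈ W, g * x ∈ W := by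
    intro g hg x hx
    induction hx using Submodule.span_induction with
    | mem x hx => obtain ⟨i, rfl⟩ := hx; exact hg i
    | zero => simp
    | add x y _ _ hx hy => rw [mul_add]; exact W.add_mem hx hy
    | smul r x _ hx => rw [mul_smul_comm]; exact W.smul_mem r hx
  let S : Subalgebra M2 A1 :=
    { carrier := {g | ∀ x ∈ W, g * x ∈ W}
      mul_mem' := fun {a b} ha hb x hx => by rw [mul_assoc]; exact ha _ (hb _ hx)
      add_mem' := fun {a b} ha hb x hx => by rw [add_mul]; exact W.add_mem (ha _ hx) (hb _ hx)
      algebraMap_mem' := fun r x hx => by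
        rw [← Algebra.smul_def]; exact W.smul_mem r hx }
  have hS : S = ⊤ := subalgebra_eq_top S (stab _ key1) (stab _ key2)
  rw [eq_top_iff]
  rintro a -
  have ha : a ∈ S := hS ▸ Algebra.mem_top
  simpa using ha 1 (hm 0)

instance finite : Module.Finite M2 A1 :=
  ⟨Submodule.fg_def.2 ⟨_, Set.finite_range _, span_mono⟩⟩

end A1

open A1

theorem Steenrod.sq_zero : Steenrod.sq 0 = 1 := by
  have h := RingQuot.mkAlgHom_rel M2 SteenrodRel.sq_zero
  rw [map_one] at h
  exact h

theorem Steenrod.adem (a b : ℕ) (ha : 0 < a) (hab : a < 2 * b) :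
    Steenrod.sq a * Steenrod.sq b =
      ∑ j ∈ Finset.range (a / 2 + 1),
          (((b - 1 - j).choose (a - 2 * j) : M2) *
              (if Even a ∧ Even b ∧ Odd j then tau else 1)) •
            (Steenrod.sq (a + b - j) * Steenrod.sq j) := by
  have h := RingQuot.mkAlgHom_rel M2 (SteenrodRel.adem a b ha hab)
  simp only [map_mul, map_sum, map_smul] at h
  exact h

theorem two_M2 : (2 : M2) = 0 := by
  have := CharP.cast_eq_zero M2 2
  simpa using this

theorem Steenrod.rel11 : Steenrod.sq 1 * Steenrod.sq 1 = 0 := by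
  rw [Steenrod.adem 1 1 (by norm_num) (by norm_num)]
  simp

theorem Steenrod.rel12 : Steenrod.sq 1 * Steenrod.sq 2 = Steenrod.sq 3 := by
  rw [Steenrod.adem 1 2 (by norm_num) (by norm_num)]
  simp [Steenrod.sq_zero]

theorem Steenrod.rel22 : Steenrod.sq 2 * Steenrod.sq 2 =
    tau • (Steenrod.sq 1 * Steenrod.sq 2 * Steenrod.sq 1) := by
  rw [Steenrod.rel12, Steenrod.adem 2 2 (by norm_num) (by norm_num)]
  simp [Finset.sum_range_succ]

theorem Steenrod.relTop :
    Steenrod.sq 1 * Steenrod.sq 2 * Steenrod.sq 1 * Steenrod.sq 2 =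
    Steenrod.sq 2 * Steenrod.sq 1 * Steenrod.sq 2 * Steenrod.sq 1 := by
  have h23 : Steenrod.sq 2 * Steenrod.sq 3 = Steenrod.sq 5 + Steenrod.sq 4 * Steenrod.sq 1 := by
    rw [Steenrod.adem 2 3 (by norm_num) (by norm_num)]
    simp [Finset.sum_range_succ, Steenrod.sq_zero, Nat.even_iff]
  have h33 : Steenrod.sq 3 * Steenrod.sq 3 = Steenrod.sq 5 * Steenrod.sq 1 := by
    rw [Steenrod.adem 3 3 (by norm_num) (by norm_num)]
    simp [Finset.sum_range_succ, Nat.even_iff]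
  calc _ = Steenrod.sq 3 * Steenrod.sq 3 := by rw [← Steenrod.rel12]; simp only [mul_assoc]
    _ = Steenrod.sq 2 * Steenrod.sq 3 * Steenrod.sq 1 := by
      rw [h33, h23, add_mul, mul_assoc _ _ (Steenrod.sq 1), Steenrod.rel11]; simp
    _ = _ := by rw [← Steenrod.rel12]; simp only [mul_assoc]

/-- The canonical map from `𝒜(1)` to the motivic Steenrod algebra. -/
def A1.toSteenrod : A1 →ₐ[M2] Steenrod :=
  A1.lift (Steenrod.sq 1) (Steenrod.sq 2) Steenrod.rel11 Steenrod.rel22 Steenrod.relTop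

theorem A1.range_toSteenrod :
    A1.toSteenrod.range = Algebra.adjoin M2 {Steenrod.sq 1, Steenrod.sq 2} := by
  rw [← Algebra.map_top, ← A1.adjoin_eq_top, AlgHom.map_adjoin, Set.image_pair]
  simp [A1.toSteenrod]

/-- Matrices of the Steenrod squares on an `8`-dimensional module over the classical Steenrod
algebra that is free of rank one over classical `𝒜(1)`; the basis corresponds to `A1.mono`. -/
def clSq : ℕ → Matrix (Fin 8) (Fin 8) (ZMod 2)
  | 0 => 1
  | 1 => Matrix.of fun t s => if (s, t) ∈ [((0 : Fin 8), (1 : Fin 8)), (2, 3), (4, 5), (6, 7)]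
      then 1 else 0
  | 2 => Matrix.of fun t s => if (s, t) ∈
      [((0 : Fin 8), (2 : Fin 8)), (1, 4), (2, 5), (3, 6), (5, 7)] then 1 else 0
  | 3 => Matrix.of fun t s => if (s, t) ∈ [((0 : Fin 8), (3 : Fin 8)), (1, 5), (3, 7)]
      then 1 else 0
  | 4 => Matrix.of fun t s => if (s, t) ∈ [((0 : Fin 8), (5 : Fin 8)), (1, 6)] then 1 else 0
  | 5 => Matrix.of fun t s => if (s, t) ∈ [((1 : Fin 8), (7 : Fin 8))] then 1 else 0
  | _ => 0

/-- The motivic squares act by `τ^⌊k/2⌋` times the classical matrices. -/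
def motSq (k : ℕ) : Matrix (Fin 8) (Fin 8) M2 :=
  (Polynomial.X ^ (k / 2) : M2) • (clSq k).map Polynomial.C

theorem clSq_eq_zero {k : ℕ} (hk : 6 ≤ k) : clSq k = 0 := by
  obtain ⟨m, rfl⟩ := Nat.exists_eq_add_of_le' hk
  rfl

theorem motSq_mul (a b : ℕ) : motSq a * motSq b =
    (Polynomial.X ^ (a / 2 + b / 2) : M2) • (clSq a * clSq b).map Polynomial.C := by
  rw [motSq, motSq, Matrix.map_mul, smul_mul_smul_comm, pow_add]

theorem clSq_adem : ∀ a ∈ Finset.Icc 1 5, ∀ b ∈ Finset.Icc 1 5, a < 2 * b →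
    clSq a * clSq b = ∑ j ∈ Finset.range (a / 2 + 1),
      (((b - 1 - j).choose (a - 2 * j) : ZMod 2) • (clSq (a + b - j) * clSq j)) := by
  decide +kernel

theorem motSq_adem (a b : ℕ) (ha : 0 < a) (hab : a < 2 * b) :
    motSq a * motSq b =
      ∑ j ∈ Finset.range (a / 2 + 1),
          (((b - 1 - j).choose (a - 2 * j) : M2) *
              (if Even a ∧ Even b ∧ Odd j then tau else 1)) •
            (motSq (a + b - j) * motSq j) := by
  by_cases h : a ≤ 5 ∧ b ≤ 5
  · obtain ⟨h5, h5'⟩ := h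
    rw [motSq_mul, clSq_adem a (by simp; omega) b (by simp; omega) hab]
    have : ∀ j ∈ Finset.range (a / 2 + 1),
        (((b - 1 - j).choose (a - 2 * j) : M2) *
              (if Even a ∧ Even b ∧ Odd j then tau else 1)) •
            (motSq (a + b - j) * motSq j) =
        (Polynomial.X ^ (a / 2 + b / 2) : M2) •
          (((b - 1 - j).choose (a - 2 * j) : ZMod 2) • (clSq (a + b - j) * clSq j)).map
            Polynomial.C := by
      intro j hj
      have e : (((b - 1 - j).choose (a - 2 * j) : ZMod 2) • (clSq (a + b - j) * clSq j)).map
            (Polynomial.C : ZMod 2 → M2) =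
          ((b - 1 - j).choose (a - 2 * j) : M2) • (clSq (a + b - j) * clSq j).map
            (Polynomial.C : ZMod 2 → M2) := by
        ext1 s t
        simp only [Matrix.map_apply, Matrix.smul_apply, smul_eq_mul, map_mul, map_natCast]
      rw [e, motSq_mul, smul_smul, smul_smul]
      congr 1
      have hb : b < 6 := by omega
      have ha' : a < 6 := by omega
      have hj' : j < 3 := by rw [Finset.mem_range] at hj; omega
      have two : (2 : M2) = 0 := two_M2
      have three : (3 : M2) = 1 := by linear_combination two_M2
      have four : (4 : M2) = 0 := by linear_combination 2 * two_M2
      have six : (6 : M2) = 0 := by linear_combination 3 * two_M2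
      clear e h5 h5'
      interval_cases a <;> interval_cases b <;> try omega
      all_goals interval_cases j
      all_goals first
        | (exfalso; simp at hj; done)
        | simp [Nat.choose, Nat.even_iff, Nat.odd_iff, pow_succ, two, three, four, six, mul_assoc]
    rw [Finset.sum_congr rfl this, ← Finset.smul_sum]
    congr 1
    ext s t
    simp [Matrix.sum_apply]
  · have z : ∀ {k : ℕ}, 6 ≤ k → motSq k = 0 := fun hk => by
      ext s t
      simp [motSq, clSq_eq_zero hk]
    rw [Finset.sum_eq_zero]
    · rcases Nat.lt_or_ge a 6 with h6 | h6
      · rw [z (k := b) (by omega), mul_zero]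
      · rw [z (k := a) h6, zero_mul]
    · intro j hj
      rw [Finset.mem_range] at hj
      rw [z (k := a + b - j) (by omega), zero_mul, smul_zero]

/-- The representation of the motivic Steenrod algebra on `M2⁸` given by `motSq`. -/
def Steenrod.rep : Steenrod →ₐ[M2] Matrix (Fin 8) (Fin 8) M2 :=
  RingQuot.liftAlgHom M2
    ⟨FreeAlgebra.lift M2 motSq, by
      intro x y h
      cases h with
      | sq_zero =>
        ext s t
        simp [motSq, clSq, Matrix.one_apply, apply_ite]
      | adem a b ha hab =>
        simp only [map_mul, map_sum, map_smul, FreeAlgebra.lift_ι_apply]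
        exact motSq_adem a b ha hab⟩

theorem Steenrod.rep_sq (k : ℕ) : Steenrod.rep (Steenrod.sq k) = motSq k := by
  simp [Steenrod.rep, Steenrod.sq]

theorem clSq_word : ∀ i : Fin 8,
    (![1, clSq 1, clSq 2, clSq 1 * clSq 2, clSq 2 * clSq 1, clSq 1 * clSq 2 * clSq 1,
      clSq 2 * clSq 1 * clSq 2, clSq 1 * clSq 2 * clSq 1 * clSq 2] i) *ᵥ Pi.single 0 1 =
      Pi.single i 1 := by
  decide +kernel

theorem A1.rep_mono (i t : Fin 8) : Steenrod.rep (A1.toSteenrod (A1.mono i)) t 0 =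
    if t = i then (Polynomial.X ^ (![0, 0, 1, 1, 1, 1, 2, 2] i : ℕ) : M2) else 0 := by
  have h := congrFun (clSq_word i) t
  rw [Matrix.mulVec_single_one, Matrix.col_apply] at h
  have e1 : motSq 1 = (clSq 1).map Polynomial.C := by simp [motSq]
  have e2 : motSq 2 = (Polynomial.X : M2) • (clSq 2).map Polynomial.C := by simp [motSq]
  have k : Steenrod.rep (A1.toSteenrod (A1.mono i)) =
      (Polynomial.X ^ (![0, 0, 1, 1, 1, 1, 2, 2] i : ℕ) : M2) •
      (![1, clSq 1, clSq 2, clSq 1 * clSq 2, clSq 2 * clSq 1, clSq 1 * clSq 2 * clSq 1,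
      clSq 2 * clSq 1 * clSq 2, clSq 1 * clSq 2 * clSq 1 * clSq 2] i).map Polynomial.C := by
    fin_cases i <;>
      simp [A1.mono, A1.toSteenrod, Steenrod.rep_sq, e1, e2, Matrix.map_mul, smul_smul, pow_two]
  rw [k, Matrix.smul_apply, Matrix.map_apply, h, Pi.single_apply]
  split_ifs <;> simp

theorem A1.toSteenrod_injective : Function.Injective A1.toSteenrod := by
  rw [injective_iff_map_eq_zero]
  intro a ha
  have hs : a ∈ Submodule.span M2 (Set.range A1.mono) := A1.span_mono ▸ Submodule.mem_top
  obtain ⟨c, rfl⟩ := (Submodule.mem_span_range_iff_exists_fun M2).1 hs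
  have hc : ∀ t, c t = 0 := by
    intro t
    have h := congrFun (congrFun (congrArg Steenrod.rep ha) t) 0
    simp only [map_sum, map_smul, map_zero, Matrix.sum_apply, Matrix.smul_apply, A1.rep_mono,
      smul_eq_mul, mul_ite, mul_zero, Finset.sum_ite_eq, Finset.mem_univ, if_true,
      Matrix.zero_apply] at h
    exact (mul_eq_zero.1 h).resolve_right (pow_ne_zero _ Polynomial.X_ne_zero)
  simp [hc]

/-! ### The coproduct and tensor products of `𝒜(1)`-modules -/

section coproduct

set_option linter.unusedSimpArgs false

variable {R : Type*} [Ring R] {t p q u v : R}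

theorem coprod_rel_aux (two : ∀ x : R, x + x = 0)
    (tp : p * t = t * p) (tq : q * t = t * q) (tu : u * t = t * u) (tv : v * t = t * v)
    (qp : q * p = p * q) (vp : v * p = p * v) (qu : q * u = u * q)
    (vu : v * u = u * v) (pp : p * p = 0) (qq : q * q = 0) (uu : u * u = t * (p * u * p))
    (vv : v * v = t * (q * v * q)) (pu : p * u * p * u = u * p * u * p)
    (qv : q * v * q * v = v * q * v * q) :
    (p + q) * (p + q) = 0 ∧
    (u + v + t * (p * q)) * (u + v + t * (p * q)) =
      t * ((p + q) * (u + v + t * (p * q)) * (p + q)) ∧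
    (p + q) * (u + v + t * (p * q)) * (p + q) * (u + v + t * (p * q)) =
      (u + v + t * (p * q)) * (p + q) * (u + v + t * (p * q)) * (p + q) := by
  have r : ∀ {a b c : R} (_ : a * b = c) (z : R), a * (b * z) = c * z :=
    fun h z => by rw [← h, mul_assoc]
  have r4 : ∀ {a b c d e : R} (_ : a * (b * (c * d)) = e) (z : R),
      a * (b * (c * (d * z))) = e * z :=
    fun h z => by rw [← h]; simp only [mul_assoc]
  have two2 : ∀ x : R, (2 : ℤ) • x = 0 := fun x => by rw [two_zsmul, two]
  simp only [mul_assoc] at uu vv pu qv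
  refine ⟨?_, ?_, ?_⟩
  · simp only [mul_add, add_mul, qp, pp, qq, add_zero, zero_add, two]
  · simp only [mul_add, add_mul, mul_assoc, tp, tq, tu, tv, qp, vp, qu, vu, pp, qq, uu, vv,
      r tp, r tq, r tu, r tv, r qp, r vp, r qu, r vu, r pp, r qq, r uu, r vv, zero_mul, mul_zero,
      add_zero, zero_add]
    abel_nf
    simp only [two2, add_zero, zero_add]
  · simp only [mul_add, add_mul, mul_assoc, tp, tq, tu, tv, qp, vp, qu, vu, pp, qq, uu, vv,
      r tp, r tq, r tu, r tv, r qp, r vp, r qu, r vu, r pp, r qq, r uu, r vv, pu, qv, r4 pu, r4 qv,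
      zero_mul, mul_zero, add_zero, zero_add]
    abel_nf
    simp only [two2, add_zero, zero_add]

end coproduct

theorem add_self_M2 {V : Type*} [AddCommGroup V] [Module M2 V] (x : V) : x + x = 0 := by
  rw [← two_smul M2 x, two_M2, zero_smul]

namespace A1

theorem comul_rel :
    (sq1 ⊗ₜ[M2] (1 : A1) + (1 : A1) ⊗ₜ[M2] sq1) * (sq1 ⊗ₜ[M2] (1 : A1) + (1 : A1) ⊗ₜ[M2] sq1) = 0 ∧
    (sq2 ⊗ₜ[M2] (1 : A1) + (1 : A1) ⊗ₜ[M2] sq2 + tau • (sq1 ⊗ₜ[M2] sq1)) *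
      (sq2 ⊗ₜ[M2] (1 : A1) + (1 : A1) ⊗ₜ[M2] sq2 + tau • (sq1 ⊗ₜ[M2] sq1)) =
      tau • ((sq1 ⊗ₜ[M2] (1 : A1) + (1 : A1) ⊗ₜ[M2] sq1) *
        (sq2 ⊗ₜ[M2] (1 : A1) + (1 : A1) ⊗ₜ[M2] sq2 + tau • (sq1 ⊗ₜ[M2] sq1)) *
        (sq1 ⊗ₜ[M2] (1 : A1) + (1 : A1) ⊗ₜ[M2] sq1)) ∧
    (sq1 ⊗ₜ[M2] (1 : A1) + (1 : A1) ⊗ₜ[M2] sq1) *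
      (sq2 ⊗ₜ[M2] (1 : A1) + (1 : A1) ⊗ₜ[M2] sq2 + tau • (sq1 ⊗ₜ[M2] sq1)) *
      (sq1 ⊗ₜ[M2] (1 : A1) + (1 : A1) ⊗ₜ[M2] sq1) *
      (sq2 ⊗ₜ[M2] (1 : A1) + (1 : A1) ⊗ₜ[M2] sq2 + tau • (sq1 ⊗ₜ[M2] sq1)) =
    (sq2 ⊗ₜ[M2] (1 : A1) + (1 : A1) ⊗ₜ[M2] sq2 + tau • (sq1 ⊗ₜ[M2] sq1)) *
      (sq1 ⊗ₜ[M2] (1 : A1) + (1 : A1) ⊗ₜ[M2] sq1) *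
      (sq2 ⊗ₜ[M2] (1 : A1) + (1 : A1) ⊗ₜ[M2] sq2 + tau • (sq1 ⊗ₜ[M2] sq1)) *
      (sq1 ⊗ₜ[M2] (1 : A1) + (1 : A1) ⊗ₜ[M2] sq1) := by
  have e : sq1 ⊗ₜ[M2] sq1 = (sq1 ⊗ₜ[M2] (1 : A1)) * ((1 : A1) ⊗ₜ[M2] sq1) := by simp
  have hc : ∀ z : A1 ⊗[M2] A1, z * algebraMap M2 (A1 ⊗[M2] A1) tau =
      algebraMap M2 (A1 ⊗[M2] A1) tau * z := fun z => (Algebra.commutes _ _).symm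
  simp only [e, Algebra.smul_def tau]
  apply coprod_rel_aux add_self_M2 (hc _) (hc _) (hc _) (hc _)
  any_goals simp only [Algebra.TensorProduct.tmul_mul_tmul, mul_one, one_mul]
  · rw [sq1_sq1, TensorProduct.zero_tmul]
  · rw [sq1_sq1, TensorProduct.tmul_zero]
  · rw [sq2_sq2, ← Algebra.smul_def, TensorProduct.smul_tmul']
  · rw [sq2_sq2, ← Algebra.smul_def, TensorProduct.tmul_smul]
  · rw [sq_top]
  · rw [sq_top]

/-- The coproduct of `𝒜(1)`: `Sq¹` is primitive and
`Δ(Sq²) = Sq² ⊗ 1 + 1 ⊗ Sq² + τ Sq¹ ⊗ Sq¹`. -/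
def comul : A1 →ₐ[M2] A1 ⊗[M2] A1 :=
  lift (sq1 ⊗ₜ[M2] 1 + 1 ⊗ₜ[M2] sq1) (sq2 ⊗ₜ[M2] 1 + 1 ⊗ₜ[M2] sq2 + tau • (sq1 ⊗ₜ[M2] sq1))
    comul_rel.1 comul_rel.2.1 comul_rel.2.2

/-- The counit of `𝒜(1)`. -/
def counit : A1 →ₐ[M2] M2 :=
  lift 0 0 (by simp) (by simp) (by simp)

end A1

section tensorAct

variable {V W U : Type*} [AddCommGroup V] [Module M2 V] [AddCommGroup W] [Module M2 W]
  [AddCommGroup U] [Module M2 U]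

/-- The action of `𝒜(1)` on the tensor product over `M2` of two `𝒜(1)`-modules, through the
coproduct. -/
def tensorAct (ρ : A1 →ₐ[M2] Module.End M2 V) (σ : A1 →ₐ[M2] Module.End M2 W) :
    A1 →ₐ[M2] Module.End M2 (V ⊗[M2] W) :=
  (Module.endTensorEndAlgHom (R := M2) (S := M2) (A := M2)).comp
    ((Algebra.TensorProduct.map ρ σ).comp comul)

/-- The trivial action of `𝒜(1)`, through the counit. -/
def trivialAct (V : Type*) [AddCommGroup V] [Module M2 V] : A1 →ₐ[M2] Module.End M2 V :=
  (Algebra.ofId M2 (Module.End M2 V)).comp counit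

variable (ρ : A1 →ₐ[M2] Module.End M2 V) (σ : A1 →ₐ[M2] Module.End M2 W)
  (θ : A1 →ₐ[M2] Module.End M2 U)

@[simp] theorem tensorAct_sq1 (x : V) (y : W) :
    tensorAct ρ σ sq1 (x ⊗ₜ y) = ρ sq1 x ⊗ₜ y + x ⊗ₜ σ sq1 y := by
  simp [tensorAct, comul, Module.endTensorEndAlgHom_apply]

@[simp] theorem tensorAct_sq2 (x : V) (y : W) :
    tensorAct ρ σ sq2 (x ⊗ₜ y) =
      ρ sq2 x ⊗ₜ y + x ⊗ₜ σ sq2 y + tau • (ρ sq1 x ⊗ₜ σ sq1 y) := by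
  simp [tensorAct, comul, Module.endTensorEndAlgHom_apply]

@[simp] theorem trivialAct_sq1 (x : V) : trivialAct V sq1 x = 0 := by
  simp [trivialAct, counit]

@[simp] theorem trivialAct_sq2 (x : V) : trivialAct V sq2 x = 0 := by
  simp [trivialAct, counit]

theorem lid_tensorAct_sq1 (z : M2 ⊗[M2] V) :
    TensorProduct.lid M2 V (tensorAct (trivialAct M2) ρ sq1 z) =
      ρ sq1 (TensorProduct.lid M2 V z) := by
  induction z with
  | zero => simp
  | tmul x y => simp
  | add y z hy hz => simp only [map_add, hy, hz]

theorem lid_tensorAct_sq2 (z : M2 ⊗[M2] V) :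
    TensorProduct.lid M2 V (tensorAct (trivialAct M2) ρ sq2 z) =
      ρ sq2 (TensorProduct.lid M2 V z) := by
  induction z with
  | zero => simp
  | tmul x y => simp
  | add y z hy hz => simp only [map_add, hy, hz]

theorem comm_tensorAct_sq1 (z : V ⊗[M2] W) :
    TensorProduct.comm M2 V W (tensorAct ρ σ sq1 z) =
      tensorAct σ ρ sq1 (TensorProduct.comm M2 V W z) := by
  induction z with
  | zero => simp
  | tmul x y => simp [add_comm]
  | add y z hy hz => simp only [map_add, hy, hz]

theorem comm_tensorAct_sq2 (z : V ⊗[M2] W) :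
    TensorProduct.comm M2 V W (tensorAct ρ σ sq2 z) =
      tensorAct σ ρ sq2 (TensorProduct.comm M2 V W z) := by
  induction z with
  | zero => simp
  | tmul x y => simp [add_comm]
  | add y z hy hz => simp only [map_add, hy, hz]

theorem assoc_tensorAct_sq1 (z : (V ⊗[M2] W) ⊗[M2] U) :
    TensorProduct.assoc M2 V W U (tensorAct (tensorAct ρ σ) θ sq1 z) =
      tensorAct ρ (tensorAct σ θ) sq1 (TensorProduct.assoc M2 V W U z) := by
  induction z with
  | zero => simp
  | tmul w y =>
    induction w with
    | zero => simp
    | tmul x w => simp [TensorProduct.add_tmul, TensorProduct.tmul_add, add_assoc]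
    | add w w' h h' => simp only [TensorProduct.add_tmul, map_add, h, h']
  | add y z hy hz => simp only [map_add, hy, hz]

theorem assoc_tensorAct_sq2 (z : (V ⊗[M2] W) ⊗[M2] U) :
    TensorProduct.assoc M2 V W U (tensorAct (tensorAct ρ σ) θ sq2 z) =
      tensorAct ρ (tensorAct σ θ) sq2 (TensorProduct.assoc M2 V W U z) := by
  induction z with
  | zero => simp
  | tmul w y =>
    induction w with
    | zero => simp
    | tmul x w =>
      simp only [tensorAct_sq2, tensorAct_sq1, TensorProduct.add_tmul, TensorProduct.tmul_add,
        map_add, map_smul, TensorProduct.assoc_tmul, smul_add, TensorProduct.tmul_smul,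
        ← TensorProduct.smul_tmul']
      abel
    | add w w' h h' => simp only [TensorProduct.add_tmul, map_add, h, h']
  | add y z hy hz => simp only [map_add, hy, hz]

variable {ρ σ} in
/-- A linear map that commutes with `Sq¹` and `Sq²` commutes with all of `𝒜(1)`. -/
theorem map_act_of_generators (f : V →ₗ[M2] W) (h1 : ∀ x, f (ρ sq1 x) = σ sq1 (f x))
    (h2 : ∀ x, f (ρ sq2 x) = σ sq2 (f x)) (a : A1) (x : V) : f (ρ a x) = σ a (f x) := by
  let S : Subalgebra M2 A1 :=
    { carrier := {a | ∀ x, f (ρ a x) = σ a (f x)}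
      mul_mem' := fun {a b} ha hb x => by
        rw [map_mul, map_mul, Module.End.mul_apply, Module.End.mul_apply, ha, hb]
      add_mem' := fun {a b} ha hb x => by
        rw [map_add, map_add, LinearMap.add_apply, LinearMap.add_apply, map_add, ha, hb]
      algebraMap_mem' := fun r x => by
        rw [AlgHom.commutes, AlgHom.commutes, Module.algebraMap_end_apply,
          Module.algebraMap_end_apply, map_smul] }
  have hS : S = ⊤ := subalgebra_eq_top S h1 h2
  have ha : a ∈ S := hS ▸ Algebra.mem_top
  exact ha x

/-- The space of a representation `ρ` of `𝒜(1)`, regarded as a left `𝒜(1)`-module. -/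
def ActMod (_ρ : A1 →ₐ[M2] Module.End M2 V) : Type _ := V

namespace ActMod

instance : AddCommGroup (ActMod ρ) := inferInstanceAs (AddCommGroup V)

instance : Module M2 (ActMod ρ) := inferInstanceAs (Module M2 V)

instance : Module A1 (ActMod ρ) :=
  letI : Module (Module.End M2 V) (ActMod ρ) := inferInstanceAs (Module (Module.End M2 V) V)
  Module.compHom (ActMod ρ) ρ.toRingHom

/-- The identity map from the underlying `M2`-module. -/
def of : V ≃ₗ[M2] ActMod ρ := LinearEquiv.refl M2 V

theorem smul_of (a : A1) (x : V) : a • of ρ x = of ρ (ρ a x) := rfl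

instance : IsScalarTower M2 A1 (ActMod ρ) :=
  ⟨fun r a x => by
    obtain ⟨x, rfl⟩ := (of ρ).surjective x
    rw [smul_of, smul_of, map_smul, LinearMap.smul_apply, map_smul]⟩

end ActMod

/-- An `𝒜(1)`-module is finitely generated if and only if it is finitely generated over `M2`. -/
theorem finite_iff (V : Type*) [AddCommGroup V] [Module M2 V] [Module A1 V]
    [IsScalarTower M2 A1 V] : Module.Finite A1 V ↔ Module.Finite M2 V :=
  ⟨fun _ => Module.Finite.trans A1 V, fun _ => Module.Finite.of_restrictScalars_finite M2 A1 V⟩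

/-- If `V` is a projective `𝒜(1)`-module and `W` is an `𝒜(1)`-module, both finitely generated and
free over `M2`, then `V ⊗ W` is projective. -/
theorem projective_tensorAct [Module.Finite M2 V] [Module.Free M2 V] [Module.Finite M2 W]
    [Module.Free M2 W] (h : Module.Projective A1 (ActMod ρ)) :
    Module.Projective A1 (ActMod (tensorAct ρ σ)) := by
  -- the free module `𝒜(1) ⊗ V`, with `𝒜(1)` acting on the left factor
  let lam : A1 →ₐ[M2] Module.End M2 (A1 ⊗[M2] V) := Algebra.lsmul M2 M2 (A1 ⊗[M2] V)
  have lam_tmul : ∀ a b (x : V), lam a (b ⊗ₜ x) = (a * b) ⊗ₜ x := fun a b x => rfl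
  let ev : A1 ⊗[M2] V →ₗ[M2] V := TensorProduct.lift (ρ.toLinearMap)
  have ev_tmul : ∀ a (x : V), ev (a ⊗ₜ x) = ρ a x := fun a x => rfl
  let evA : A1 ⊗[M2] V →ₗ[A1] ActMod ρ :=
    { toFun := fun z => ActMod.of ρ (ev z)
      map_add' := fun x y => by simp
      map_smul' := fun a z => by
        rw [RingHom.id_apply, ActMod.smul_of]
        congr 1
        induction z with
        | zero => simp
        | tmul b x => rw [TensorProduct.smul_tmul', ev_tmul, ev_tmul, smul_eq_mul, map_mul]; rfl
        | add y z hy hz => rw [smul_add, map_add, hy, hz, map_add, map_add] }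
  have evA_surj : Function.Surjective evA := fun x => ⟨1 ⊗ₜ (ActMod.of ρ).symm x, by
    change ActMod.of ρ (ev (1 ⊗ₜ (ActMod.of ρ).symm x)) = x
    rw [ev_tmul, map_one, Module.End.one_apply, LinearEquiv.apply_symm_apply]⟩
  obtain ⟨s, hs⟩ := Module.projective_lifting_property evA LinearMap.id evA_surj
  -- the section, as an `M2`-linear map commuting with the actions
  let s0 : V →ₗ[M2] A1 ⊗[M2] V := (s.restrictScalars M2).comp (ActMod.of ρ).toLinearMap
  have s0_act : ∀ a x, s0 (ρ a x) = lam a (s0 x) := fun a x => by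
    change s (ActMod.of ρ (ρ a x)) = a • s (ActMod.of ρ x)
    rw [← ActMod.smul_of, map_smul]
  have ev_s0 : ∀ x, ev (s0 x) = x := fun x => by
    have := LinearMap.congr_fun hs (ActMod.of ρ x)
    exact (ActMod.of ρ).injective this
  -- shearing
  let T := tensorAct lam σ
  let sh : A1 ⊗[M2] (V ⊗[M2] W) →ₗ[M2] (A1 ⊗[M2] V) ⊗[M2] W :=
    TensorProduct.lift
      (LinearMap.flip ((LinearMap.flip T.toLinearMap).comp
        (TensorProduct.map (TensorProduct.mk M2 A1 V 1) LinearMap.id)))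
  have sh_tmul : ∀ a (z : V ⊗[M2] W),
      sh (a ⊗ₜ z) = T a (TensorProduct.map (TensorProduct.mk M2 A1 V 1) LinearMap.id z) :=
    fun a z => rfl
  have sh_act : ∀ a z, sh (a • z) = T a (sh z) := fun a z => by
    induction z with
    | zero => simp
    | tmul b x =>
      rw [TensorProduct.smul_tmul', sh_tmul, sh_tmul, smul_eq_mul, map_mul, Module.End.mul_apply]
    | add y z hy hz => rw [smul_add, map_add, hy, hz, map_add, map_add]
  have sh_surj : Function.Surjective sh := by
    have hr : ∀ a z, z ∈ LinearMap.range sh → T a z ∈ LinearMap.range sh := by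
      rintro a _ ⟨z, rfl⟩
      exact ⟨a • z, sh_act a z⟩
    let P : Submodule M2 A1 :=
      { carrier := {a | ∀ (x : V) (y : W), (a ⊗ₜ[M2] x) ⊗ₜ[M2] y ∈ LinearMap.range sh}
        zero_mem' := fun x y => by simp
        add_mem' := fun {a b} ha hb x y => by
          rw [TensorProduct.add_tmul, TensorProduct.add_tmul]
          exact Submodule.add_mem _ (ha x y) (hb x y)
        smul_mem' := fun r a ha x y => by
          rw [← TensorProduct.smul_tmul', ← TensorProduct.smul_tmul']
          exact Submodule.smul_mem _ r (ha x y) }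
    have P1 : (1 : A1) ∈ P := fun x y => ⟨1 ⊗ₜ (x ⊗ₜ y), by
      rw [sh_tmul, map_one]; rfl⟩
    have two_z : ∀ z : (A1 ⊗[M2] V) ⊗[M2] W, z + z = 0 := fun z => add_self_M2 z
    have Ps1 : ∀ a ∈ P, sq1 * a ∈ P := fun a ha x y => by
      have h1 := hr sq1 _ (ha x y)
      rw [tensorAct_sq1, lam_tmul] at h1
      have h2 := Submodule.add_mem _ h1 (ha x (σ sq1 y))
      rwa [add_assoc, two_z, add_zero] at h2
    have Ps2 : ∀ a ∈ P, sq2 * a ∈ P := fun a ha x y => by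
      have h1 := hr sq2 _ (ha x y)
      rw [tensorAct_sq2, lam_tmul, lam_tmul] at h1
      have h2 := Submodule.smul_mem _ tau (Ps1 a ha x (σ sq1 y))
      have h3 := Submodule.add_mem _ (Submodule.add_mem _ h1 h2) (ha x (σ sq2 y))
      rwa [add_assoc _ (tau • _) (tau • _), two_z, add_zero, add_assoc, two_z, add_zero] at h3
    let S : Subalgebra M2 A1 :=
      { carrier := {g | ∀ a ∈ P, g * a ∈ P}
        mul_mem' := fun {a b} ha hb x hx => by rw [mul_assoc]; exact ha _ (hb _ hx)
        add_mem' := fun {a b} ha hb x hx => by rw [add_mul]; exact P.add_mem (ha _ hx) (hb _ hx)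
        algebraMap_mem' := fun r x hx => by
          rw [← Algebra.smul_def]; exact P.smul_mem r hx }
    have hS : S = ⊤ := subalgebra_eq_top S Ps1 Ps2
    have hP : ∀ a, a ∈ P := fun a => by
      have ha : a ∈ S := hS ▸ Algebra.mem_top
      simpa using ha 1 P1
    rw [← LinearMap.range_eq_top, eq_top_iff]
    rintro z -
    induction z with
    | zero => exact Submodule.zero_mem _
    | tmul w y =>
      induction w with
      | zero => rw [TensorProduct.zero_tmul]; exact Submodule.zero_mem _
      | tmul a x => exact hP a x y
      | add w w' h h' => rw [TensorProduct.add_tmul]; exact Submodule.add_mem _ h h'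
    | add w w' h h' => exact Submodule.add_mem _ h h'
  have sh_inj : Function.Injective sh := by
    have hcomp : Function.Surjective
        ((TensorProduct.assoc M2 A1 V W).toLinearMap.comp sh) :=
      (TensorProduct.assoc M2 A1 V W).surjective.comp sh_surj
    have := OrzechProperty.injective_of_surjective_endomorphism _ hcomp
    rw [LinearMap.coe_comp] at this
    exact this.of_comp
  let shE : A1 ⊗[M2] (V ⊗[M2] W) ≃ₗ[M2] (A1 ⊗[M2] V) ⊗[M2] W :=
    LinearEquiv.ofBijective sh ⟨sh_inj, sh_surj⟩
  have shE_symm : ∀ a z, shE.symm (T a z) = a • shE.symm z := fun a z => by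
    obtain ⟨z, rfl⟩ := shE.surjective z
    rw [LinearEquiv.symm_apply_apply, LinearEquiv.symm_apply_eq]
    exact (sh_act a z).symm
  -- the retraction
  have hi : ∀ a z, TensorProduct.map s0 LinearMap.id (tensorAct ρ σ a z) =
      T a (TensorProduct.map s0 (LinearMap.id : W →ₗ[M2] W) z) := by
    intro a z
    refine map_act_of_generators (V := V ⊗[M2] W)
      (W := (A1 ⊗[M2] V) ⊗[M2] W) (ρ := tensorAct ρ σ) (σ := T)
      (TensorProduct.map s0 (LinearMap.id : W →ₗ[M2] W)) (fun z => ?_) (fun z => ?_) a z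
    · induction z with
      | zero => simp
      | tmul x y => simp [T, s0_act]
      | add y z hy hz => simp only [map_add, hy, hz]
    · induction z with
      | zero => simp
      | tmul x y => simp [T, s0_act]
      | add y z hy hz => simp only [map_add, hy, hz]
  have hp : ∀ a z, TensorProduct.map ev LinearMap.id (T a z) =
      tensorAct ρ σ a (TensorProduct.map ev (LinearMap.id : W →ₗ[M2] W) z) := by
    have ev_act : ∀ a z, ev (lam a z) = ρ a (ev z) := fun a z =>
      (ActMod.of ρ).injective (evA.map_smul a z)
    intro a z
    refine map_act_of_generators (W := V ⊗[M2] W)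
      (V := (A1 ⊗[M2] V) ⊗[M2] W) (ρ := T) (σ := tensorAct ρ σ)
      (TensorProduct.map ev (LinearMap.id : W →ₗ[M2] W)) (fun z => ?_) (fun z => ?_) a z
    · induction z with
      | zero => simp
      | tmul x y => simp [T, ev_act]
      | add y z hy hz => simp only [map_add, hy, hz]
    · induction z with
      | zero => simp
      | tmul x y => simp [T, ev_act]
      | add y z hy hz => simp only [map_add, hy, hz]
  let iA : ActMod (tensorAct ρ σ) →ₗ[A1] A1 ⊗[M2] (V ⊗[M2] W) :=
    { toFun := fun z => shE.symm (TensorProduct.map s0 LinearMap.id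
        ((ActMod.of (tensorAct ρ σ)).symm z))
      map_add' := fun x y => by simp
      map_smul' := fun a z => by
        obtain ⟨z, rfl⟩ := (ActMod.of (tensorAct ρ σ)).surjective z
        rw [ActMod.smul_of, LinearEquiv.symm_apply_apply, LinearEquiv.symm_apply_apply, hi,
          shE_symm, RingHom.id_apply] }
  let pA : A1 ⊗[M2] (V ⊗[M2] W) →ₗ[A1] ActMod (tensorAct ρ σ) :=
    { toFun := fun z => ActMod.of (tensorAct ρ σ) (TensorProduct.map ev LinearMap.id (sh z))
      map_add' := fun x y => by simp
      map_smul' := fun a z => by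
        rw [sh_act, hp, RingHom.id_apply, ActMod.smul_of] }
  refine Module.Projective.of_split iA pA ?_
  ext z
  obtain ⟨z, rfl⟩ := (ActMod.of (tensorAct ρ σ)).surjective z
  change ActMod.of (tensorAct ρ σ) (TensorProduct.map ev LinearMap.id
    (shE (shE.symm (TensorProduct.map s0 LinearMap.id z)))) = _
  rw [LinearEquiv.apply_symm_apply]
  have : (TensorProduct.map ev (LinearMap.id : W →ₗ[M2] W)).comp
      (TensorProduct.map s0 LinearMap.id) = LinearMap.id := by
    rw [← TensorProduct.map_comp]
    have : ev.comp s0 = LinearMap.id := LinearMap.ext ev_s0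
    rw [this, LinearMap.comp_id, TensorProduct.map_id]
  exact congrArg (ActMod.of (tensorAct ρ σ)) (LinearMap.congr_fun this z)

end tensorAct

/-! ### Bigraded modules -/

section grading

variable {X : Type*} [AddCommGroup X] {gr : ℤ × ℤ → AddSubgroup X}

theorem isInternal_of_separator (D : X →+ (ℤ × ℤ →₀ X))
    (hD : ∀ d, ∀ x ∈ gr d, D x = Finsupp.single d x) (hgr : ⨆ d, gr d = ⊤) :
    DirectSum.IsInternal gr := by
  have key : ∀ (v : DirectSum (ℤ × ℤ) fun d => gr d) (d : ℤ × ℤ),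
      D (DirectSum.coeAddMonoidHom gr v) d = v d := by
    intro v d
    induction v using DirectSum.induction_on with
    | zero => simp
    | of i x =>
      rw [DirectSum.coeAddMonoidHom_of, hD i x x.2, Finsupp.single_apply, DirectSum.coe_of_apply]
      split_ifs <;> rfl
    | add v w hv hw => simp [hv, hw]
  refine ⟨fun v w h => ?_, fun x => ?_⟩
  · refine DFinsupp.ext fun d => Subtype.ext ?_
    rw [← key v d, ← key w d, h]
  · have hx : x ∈ ⨆ d, gr d := hgr ▸ AddSubgroup.mem_top x
    induction hx using AddSubgroup.iSup_induction' with
    | hp d x hx => exact ⟨DirectSum.of (fun d => gr d) d ⟨x, hx⟩, by simp⟩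
    | h1 => exact ⟨0, by simp⟩
    | hadd x y _ _ hx hy =>
      obtain ⟨v, rfl⟩ := hx
      obtain ⟨w, rfl⟩ := hy
      exact ⟨v + w, by simp⟩

theorem exists_separator (h : DirectSum.IsInternal gr) :
    ∃ D : X →+ (ℤ × ℤ →₀ X), ∀ d, ∀ x ∈ gr d, D x = Finsupp.single d x := by
  let e := AddEquiv.ofBijective _ h
  refine ⟨(DirectSum.toAddMonoid fun d => (Finsupp.singleAddHom d).comp (gr d).subtype).comp
    e.symm.toAddMonoidHom, fun d x hx => ?_⟩
  have : e.symm x = DirectSum.of (fun d => gr d) d ⟨x, hx⟩ := by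
    rw [AddEquiv.symm_apply_eq]
    exact (DirectSum.coeAddMonoidHom_of gr d ⟨x, hx⟩).symm
  simp [this]

theorem iSup_eq_top_of_isInternal (h : DirectSum.IsInternal gr) : ⨆ d, gr d = ⊤ := by
  rw [eq_top_iff]
  rintro x -
  obtain ⟨v, rfl⟩ := h.2 x
  induction v using DirectSum.induction_on with
  | zero => simp
  | of i x => rw [DirectSum.coeAddMonoidHom_of]; exact AddSubgroup.mem_iSup_of_mem i x.2
  | add v w hv hw => rw [map_add]; exact AddSubgroup.add_mem _ hv hw

/-- Induction over the homogeneous elements of a graded group. -/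
theorem homogeneous_induction (h : DirectSum.IsInternal gr) {P : X → Prop}
    (hom : ∀ d, ∀ x ∈ gr d, P x) (add : ∀ x y, P x → P y → P (x + y)) (x : X) : P x := by
  have hx : x ∈ ⨆ d, gr d := iSup_eq_top_of_isInternal h ▸ AddSubgroup.mem_top x
  induction hx using AddSubgroup.iSup_induction' with
  | hp d x hx => exact hom d x hx
  | h1 => exact hom 0 0 (AddSubgroup.zero_mem _)
  | hadd x y _ _ hx hy => exact add x y hx hy

end grading

open CategoryTheory

/-- A bigraded finitely generated left `𝒜(1)`-module that is free over `M2`. The summand of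
bidegree `(s, w)` is `gr (s, w)`; multiplication by `τ`, `Sq¹`, `Sq²` has bidegree
`(0,1)`, `(1,0)`, `(2,1)`. Finite generation over `𝒜(1)` is the same as finite generation over
`M2`, see `finite_iff`. -/
structure A1Mod : Type 1 where
  /-- The underlying set. -/
  carrier : Type
  [addCommGroup : AddCommGroup carrier]
  [module : Module M2 carrier]
  /-- The action of `𝒜(1)`. -/
  act : A1 →ₐ[M2] Module.End M2 carrier
  /-- The bigrading. -/
  gr : ℤ × ℤ → AddSubgroup carrier
  isInternal : DirectSum.IsInternal gr
  tau_mem : ∀ d, ∀ x ∈ gr d, tau • x ∈ gr (d + (0, 1))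
  sq1_mem : ∀ d, ∀ x ∈ gr d, act sq1 x ∈ gr (d + (1, 0))
  sq2_mem : ∀ d, ∀ x ∈ gr d, act sq2 x ∈ gr (d + (2, 1))
  finite : Module.Finite M2 carrier
  free : Module.Free M2 carrier

attribute [instance] A1Mod.addCommGroup A1Mod.module A1Mod.finite A1Mod.free

namespace A1Mod

/-- Homomorphisms of bigraded `𝒜(1)`-modules: `𝒜(1)`-linear maps that preserve bidegrees. -/
@[ext] structure Hom (M N : A1Mod) : Type where
  /-- The underlying `M2`-linear map. -/
  toLin : M.carrier →ₗ[M2] N.carrier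
  map_act : ∀ a x, toLin (M.act a x) = N.act a (toLin x)
  map_gr : ∀ d, ∀ x ∈ M.gr d, toLin x ∈ N.gr d

instance : Category A1Mod where
  Hom := Hom
  id M := ⟨LinearMap.id, fun _ _ => rfl, fun _ _ h => h⟩
  comp f g := ⟨g.toLin.comp f.toLin, fun a x => by simp [f.map_act, g.map_act],
    fun d x h => g.map_gr d _ (f.map_gr d x h)⟩

@[simp] theorem id_toLin (M : A1Mod) : Hom.toLin (𝟙 M) = LinearMap.id := rfl

@[simp] theorem comp_toLin {M N P : A1Mod} (f : M ⟶ N) (g : N ⟶ P) :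
    Hom.toLin (f ≫ g) = g.toLin.comp f.toLin := rfl

@[ext] theorem hom_ext {M N : A1Mod} {f g : M ⟶ N} (h : f.toLin = g.toLin) : f = g :=
  Hom.ext h

/-- `M` is projective as an `𝒜(1)`-module. -/
def IsProjective (M : A1Mod) : Prop := Module.Projective A1 (ActMod M.act)

/-- Two morphisms are stably equivalent if their difference factors through a projective
module. -/
def StablyEq : HomRel A1Mod := fun M N f g =>
  ∃ (P : A1Mod) (h : M ⟶ P) (k : P ⟶ N), P.IsProjective ∧ f.toLin - g.toLin = (h ≫ k).toLin

/-! #### Direct sums -/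

/-- The direct sum of two modules. -/
def prod (M N : A1Mod) : A1Mod where
  carrier := M.carrier × N.carrier
  act := AlgHom.ofLinearMap
    { toFun := fun a => LinearMap.prodMap (M.act a) (N.act a)
      map_add' := fun a b => by ext <;> simp
      map_smul' := fun r a => by ext <;> simp }
    (by ext <;> simp) (fun a b => by ext <;> simp)
  gr d := (M.gr d).prod (N.gr d)
  isInternal := by
    obtain ⟨D, hD⟩ := exists_separator M.isInternal
    obtain ⟨E, hE⟩ := exists_separator N.isInternal
    refine isInternal_of_separator
      (((Finsupp.mapRange.addMonoidHom (AddMonoidHom.inl M.carrier N.carrier)).comp D).comp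
          (AddMonoidHom.fst _ _) +
        ((Finsupp.mapRange.addMonoidHom (AddMonoidHom.inr M.carrier N.carrier)).comp E).comp
          (AddMonoidHom.snd _ _)) ?_ ?_
    · rintro d ⟨x, y⟩ ⟨hx, hy⟩
      simp only [AddMonoidHom.add_apply, AddMonoidHom.comp_apply, AddMonoidHom.coe_fst,
        AddMonoidHom.coe_snd]
      rw [hD d x hx, hE d y hy]
      simp [← Finsupp.single_add]
    · rw [eq_top_iff]
      rintro ⟨x, y⟩ -
      have hx : ((x, 0) : M.carrier × N.carrier) ∈ ⨆ d, (M.gr d).prod (N.gr d) := by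
        induction x using homogeneous_induction M.isInternal with
        | hom d x hx =>
          exact AddSubgroup.mem_iSup_of_mem d ⟨hx, AddSubgroup.zero_mem _⟩
        | add x y hx hy => simpa using AddSubgroup.add_mem _ hx hy
      have hy : ((0, y) : M.carrier × N.carrier) ∈ ⨆ d, (M.gr d).prod (N.gr d) := by
        induction y using homogeneous_induction N.isInternal with
        | hom d x hx =>
          exact AddSubgroup.mem_iSup_of_mem d ⟨AddSubgroup.zero_mem _, hx⟩
        | add x y hx hy => simpa using AddSubgroup.add_mem _ hx hy
      simpa using AddSubgroup.add_mem _ hx hy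
  tau_mem d x hx := ⟨M.tau_mem d _ hx.1, N.tau_mem d _ hx.2⟩
  sq1_mem d x hx := ⟨M.sq1_mem d _ hx.1, N.sq1_mem d _ hx.2⟩
  sq2_mem d x hx := ⟨M.sq2_mem d _ hx.1, N.sq2_mem d _ hx.2⟩
  finite := inferInstance
  free := inferInstance

theorem IsProjective.prod {M N : A1Mod} (hM : M.IsProjective) (hN : N.IsProjective) :
    (A1Mod.prod M N).IsProjective := by
  have : Module.Projective A1 (ActMod M.act) := hM
  have : Module.Projective A1 (ActMod N.act) := hN
  let e : (ActMod M.act × ActMod N.act) ≃ₗ[A1] ActMod (A1Mod.prod M N).act :=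
    { AddEquiv.refl (M.carrier × N.carrier) with
      map_smul' := fun _ _ => rfl }
  exact Module.Projective.of_equiv e

/-- Stable equivalence of morphisms is an equivalence relation compatible with composition, so
morphisms of the quotient category are classes modulo `StablyEq` itself. -/
instance : Congruence StablyEq where
  equivalence {M N} :=
    { refl := fun f => by
        let Z : A1Mod :=
          { carrier := PUnit
            act := trivialAct PUnit
            gr := fun _ => ⊤
            isInternal := isInternal_of_separator 0
              (fun d x _ => Subsingleton.elim _ _) (Subsingleton.elim _ _)
            tau_mem := fun _ _ _ => trivial
            sq1_mem := fun _ _ _ => trivial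
            sq2_mem := fun _ _ _ => trivial
            finite := inferInstance
            free := inferInstance }
        have : Subsingleton (ActMod Z.act) := inferInstanceAs (Subsingleton PUnit)
        refine ⟨Z, ⟨0, fun _ _ => rfl, fun _ _ _ => trivial⟩,
          ⟨0, fun _ _ => by simp, fun d x _ => by simp⟩,
          inferInstanceAs (Module.Projective A1 (ActMod Z.act)), ?_⟩
        rw [comp_toLin]
        simp
      symm := fun {f g} ⟨P, h, k, hP, e⟩ =>
        ⟨P, h, ⟨-k.toLin, fun a x => by simp [k.map_act],
          fun d x hx => (N.gr d).neg_mem (k.map_gr d x hx)⟩, hP, by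
          rw [← neg_sub, e]
          rfl⟩
      trans := fun {f g g'} ⟨P, h, k, hP, e⟩ ⟨P', h', k', hP', e'⟩ =>
        ⟨A1Mod.prod P P',
          ⟨LinearMap.prod h.toLin h'.toLin,
            fun a x => Prod.ext (h.map_act a x) (h'.map_act a x),
            fun d x hx => ⟨h.map_gr d x hx, h'.map_gr d x hx⟩⟩,
          ⟨LinearMap.coprod k.toLin k'.toLin,
            fun a x => by
              change k.toLin (P.act a x.1) + k'.toLin (P'.act a x.2) =
                N.act a (k.toLin x.1 + k'.toLin x.2)
              rw [k.map_act, k'.map_act, map_add],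
            fun d x hx => (N.gr d).add_mem (k.map_gr d _ hx.1) (k'.map_gr d _ hx.2)⟩,
          hP.prod hP', by
          rw [← sub_add_sub_cancel, e, e']
          rfl⟩ }
  comp_left := fun {M N K} f g g' ⟨P, h, k, hP, e⟩ => ⟨P, f ≫ h, k, hP, by
    rw [Category.assoc, comp_toLin, comp_toLin, comp_toLin, ← e, LinearMap.sub_comp]⟩
  comp_right := fun {M N K} f f' g ⟨P, h, k, hP, e⟩ => ⟨P, h, k ≫ g, hP, by
    rw [← Category.assoc, comp_toLin, comp_toLin, comp_toLin, ← e, LinearMap.comp_sub]⟩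

/-! #### Tensor products -/

/-- The bigrading of the tensor product: the part of bidegree `d` is generated by the `x ⊗ y` with
`x`, `y` homogeneous of bidegrees adding up to `d`. -/
def tensorGr (M N : A1Mod) (d : ℤ × ℤ) : AddSubgroup (M.carrier ⊗[M2] N.carrier) :=
  AddSubgroup.closure {z | ∃ i j, i + j = d ∧ ∃ x ∈ M.gr i, ∃ y ∈ N.gr j, z = x ⊗ₜ y}

theorem tmul_mem_tensorGr {M N : A1Mod} {i j d : ℤ × ℤ} (h : i + j = d) {x : M.carrier}
    {y : N.carrier} (hx : x ∈ M.gr i) (hy : y ∈ N.gr j) : x ⊗ₜ y ∈ tensorGr M N d :=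
  AddSubgroup.subset_closure ⟨i, j, h, x, hx, y, hy, rfl⟩

theorem tensorGr_map {M N : A1Mod} {X : Type*} [AddCommGroup X] (f : M.carrier ⊗[M2] N.carrier →+ X)
    (d : ℤ × ℤ) (S : AddSubgroup X)
    (h : ∀ i j, i + j = d → ∀ x ∈ M.gr i, ∀ y ∈ N.gr j, f (x ⊗ₜ y) ∈ S) :
    ∀ z ∈ tensorGr M N d, f z ∈ S := by
  intro z hz
  have : tensorGr M N d ≤ S.comap f := by
    rw [tensorGr, AddSubgroup.closure_le]
    rintro _ ⟨i, j, hij, x, hx, y, hy, rfl⟩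
    exact h i j hij x hx y hy
  exact this hz

theorem tensor_isInternal (M N : A1Mod) : DirectSum.IsInternal (tensorGr M N) := by
  obtain ⟨D, hD⟩ := exists_separator M.isInternal
  obtain ⟨E, hE⟩ := exists_separator N.isInternal
  let T := M.carrier ⊗[M2] N.carrier
  let B : ℤ × ℤ → ℤ × ℤ → M.carrier →+ N.carrier →+ (ℤ × ℤ →₀ T) := fun i j =>
    AddMonoidHom.mk' (fun x => AddMonoidHom.mk' (fun y => Finsupp.single (i + j) (x ⊗ₜ[M2] y))
        (fun y y' => by rw [TensorProduct.tmul_add, Finsupp.single_add]))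
      (fun x x' => by
        ext1 y
        simp [TensorProduct.add_tmul])
  let C : (ℤ × ℤ →₀ M.carrier) →+ (ℤ × ℤ →₀ N.carrier) →+ (ℤ × ℤ →₀ T) :=
    Finsupp.liftAddHom fun i => AddMonoidHom.flip (Finsupp.liftAddHom fun j => (B i j).flip)
  have hC : ∀ i j x y, C (Finsupp.single i x) (Finsupp.single j y) =
      Finsupp.single (i + j) (x ⊗ₜ[M2] y) := fun i j x y => by
    simp [C, B]
  let F : M.carrier →+ N.carrier →+ (ℤ × ℤ →₀ T) :=
    AddMonoidHom.mk' (fun x => (C (D x)).comp E) (fun x x' => by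
      ext1 y
      simp)
  have hF : ∀ i j, ∀ x ∈ M.gr i, ∀ y ∈ N.gr j, F x y = Finsupp.single (i + j) (x ⊗ₜ[M2] y) :=
    fun i j x hx y hy => by
      change C (D x) (E y) = _
      rw [hD i x hx, hE j y hy, hC]
  have htau : ∀ x y, F (tau • x) y = F x (tau • y) := by
    intro x y
    induction x using homogeneous_induction M.isInternal with
    | hom i x hx =>
      induction y using homogeneous_induction N.isInternal with
      | hom j y hy =>
        rw [hF _ _ _ (M.tau_mem i x hx) _ hy, hF _ _ _ hx _ (N.tau_mem j y hy),
          TensorProduct.smul_tmul, add_right_comm, add_assoc]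
      | add y y' h h' => rw [map_add, smul_add, map_add, h, h']
    | add x x' h h' =>
      rw [smul_add, map_add, map_add, AddMonoidHom.add_apply, AddMonoidHom.add_apply, h, h']
  have hbal : ∀ (r : M2) x y, F (r • x) y = F x (r • y) := by
    intro r
    induction r using Polynomial.induction_on' with
    | add p q hp hq =>
      intro x y
      rw [add_smul, add_smul, map_add, map_add, AddMonoidHom.add_apply, hp, hq]
    | monomial n c =>
      rw [← Polynomial.C_mul_X_pow_eq_monomial]
      have hc : (Polynomial.C c : M2) = 0 ∨ (Polynomial.C c : M2) = 1 := by
        have : ∀ c : ZMod 2, c = 0 ∨ c = 1 := by decide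
        rcases this c with rfl | rfl <;> simp
      rcases hc with hc | hc <;> rw [hc]
      · intro x y
        simp
      · rw [one_mul]
        induction n with
        | zero => intro x y; simp
        | succ n ih =>
          intro x y
          rw [pow_succ, mul_smul, ih, htau, ← mul_smul, ← pow_succ', pow_succ]
  let G : T →+ (ℤ × ℤ →₀ T) := TensorProduct.liftAddHom F hbal
  have hG : ∀ x y, G (x ⊗ₜ y) = F x y := fun x y => rfl
  refine isInternal_of_separator G (fun d z hz => ?_) ?_
  · have := tensorGr_map (G - Finsupp.singleAddHom d) d ⊥ (fun i j hij x hx y hy => by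
      rw [AddSubgroup.mem_bot, AddMonoidHom.sub_apply, hG, hF i j x hx y hy, hij]
      simp) z hz
    rw [AddSubgroup.mem_bot, AddMonoidHom.sub_apply, sub_eq_zero] at this
    exact this
  · rw [eq_top_iff]
    rintro z -
    induction z with
    | zero => exact AddSubgroup.zero_mem _
    | tmul x y =>
      induction x using homogeneous_induction M.isInternal with
      | hom i x hx =>
        induction y using homogeneous_induction N.isInternal with
        | hom j y hy => exact AddSubgroup.mem_iSup_of_mem (i + j) (tmul_mem_tensorGr rfl hx hy)
        | add y y' h h' => rw [TensorProduct.tmul_add]; exact AddSubgroup.add_mem _ h h'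
      | add x x' h h' => rw [TensorProduct.add_tmul]; exact AddSubgroup.add_mem _ h h'
    | add z z' h h' => exact AddSubgroup.add_mem _ h h'

/-- The tensor product over `M2` of two bigraded `𝒜(1)`-modules. -/
def tensor (M N : A1Mod) : A1Mod where
  carrier := M.carrier ⊗[M2] N.carrier
  act := tensorAct M.act N.act
  gr := tensorGr M N
  isInternal := tensor_isInternal M N
  tau_mem d := tensorGr_map (DistribSMul.toAddMonoidHom _ tau) d _ fun i j hij x hx y hy => by
    rw [DistribSMul.toAddMonoidHom_apply, TensorProduct.smul_tmul']
    exact tmul_mem_tensorGr (by rw [← hij, add_right_comm]) (M.tau_mem i x hx) hy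
  sq1_mem d := tensorGr_map (tensorAct M.act N.act sq1).toAddMonoidHom d _
    fun i j hij x hx y hy => by
      rw [LinearMap.toAddMonoidHom_coe, tensorAct_sq1]
      exact AddSubgroup.add_mem _
        (tmul_mem_tensorGr (by rw [← hij, add_right_comm]) (M.sq1_mem i x hx) hy)
        (tmul_mem_tensorGr (by rw [← hij, add_assoc]) hx (N.sq1_mem j y hy))
  sq2_mem d := tensorGr_map (tensorAct M.act N.act sq2).toAddMonoidHom d _
    fun i j hij x hx y hy => by
      rw [LinearMap.toAddMonoidHom_coe, tensorAct_sq2, TensorProduct.smul_tmul']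
      refine AddSubgroup.add_mem _ (AddSubgroup.add_mem _
        (tmul_mem_tensorGr (by rw [← hij, add_right_comm]) (M.sq2_mem i x hx) hy)
        (tmul_mem_tensorGr (by rw [← hij, add_assoc]) hx (N.sq2_mem j y hy)))
        (tmul_mem_tensorGr ?_ (M.tau_mem _ _ (M.sq1_mem i x hx)) (N.sq1_mem j y hy))
      rw [← hij]
      ext <;> simp <;> ring
  finite := inferInstance
  free := inferInstance

/-- The tensor product of two homomorphisms. -/
def tensorHom {M M' N N' : A1Mod} (f : M ⟶ M') (g : N ⟶ N') : M.tensor N ⟶ M'.tensor N' where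
  toLin := TensorProduct.map f.toLin g.toLin
  map_act := map_act_of_generators (ρ := tensorAct M.act N.act) (σ := tensorAct M'.act N'.act) _
    (fun z => by
      induction z with
      | zero => simp
      | tmul x y => simp [f.map_act, g.map_act]
      | add y z hy hz => simp only [map_add, hy, hz])
    (fun z => by
      induction z with
      | zero => simp
      | tmul x y => simp [f.map_act, g.map_act]
      | add y z hy hz => simp only [map_add, hy, hz])
  map_gr d := tensorGr_map (TensorProduct.map f.toLin g.toLin).toAddMonoidHom d _
    fun i j hij x hx y hy => tmul_mem_tensorGr hij (f.map_gr i x hx) (g.map_gr j y hy)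

/-- An isomorphism of modules from an `M2`-linear equivalence that commutes with `Sq¹`, `Sq²` and
preserves bidegrees. -/
def mkIso {M N : A1Mod} (e : M.carrier ≃ₗ[M2] N.carrier)
    (h1 : ∀ x, e (M.act sq1 x) = N.act sq1 (e x)) (h2 : ∀ x, e (M.act sq2 x) = N.act sq2 (e x))
    (h : ∀ d, ∀ x ∈ M.gr d, e x ∈ N.gr d) (h' : ∀ d, ∀ x ∈ N.gr d, e.symm x ∈ M.gr d) :
    M ≅ N where
  hom := ⟨e.toLinearMap, map_act_of_generators e.toLinearMap h1 h2, h⟩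
  inv := ⟨e.symm.toLinearMap, map_act_of_generators e.symm.toLinearMap
    (fun x => by
      obtain ⟨x, rfl⟩ := e.surjective x
      simp [← h1])
    (fun x => by
      obtain ⟨x, rfl⟩ := e.surjective x
      simp [← h2]), h'⟩
  hom_inv_id := by ext x; simp
  inv_hom_id := by ext x; simp

/-! #### Modules with a homogeneous basis, and the unit -/

/-- The coefficients of a polynomial, placed in degrees `e + (0, k)`. -/
def polySep {X : Type*} [AddCommGroup X] (e : ℤ × ℤ) (φ : M2 →+ X) : M2 →+ (ℤ × ℤ →₀ X) :=
  AddMonoidHom.mk'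
    (fun p => p.sum fun k c => Finsupp.single (e + (0, (k : ℤ))) (φ (Polynomial.monomial k c)))
    (fun p q => Polynomial.sum_add_index p q _ (fun k => by simp) (fun k a b => by simp))

theorem polySep_eq {X : Type*} [AddCommGroup X] (e : ℤ × ℤ) (φ : M2 →+ X) (d : ℤ × ℤ) (p : M2)
    (h : ∀ k : ℕ, p.coeff k ≠ 0 → e + (0, (k : ℤ)) = d) :
    polySep e φ p = Finsupp.single d (φ p) := by
  conv_rhs => rw [← Polynomial.sum_monomial_eq p]
  rw [Polynomial.sum_def, map_sum, ← Finsupp.singleAddHom_apply, map_sum]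
  refine Finset.sum_congr rfl fun k hk => ?_
  beta_reduce
  rw [h k (Polynomial.mem_support_iff.1 hk)]
  rfl

/-- The bigrading on `M2^ι` in which the `i`-th basis vector has bidegree `deg i`, and `τ` has
bidegree `(0,1)`. -/
def freeGr {ι : Type} (deg : ι → ℤ × ℤ) (d : ℤ × ℤ) : AddSubgroup (ι → M2) where
  carrier := {v | ∀ i, ∀ k : ℕ, (v i).coeff k ≠ 0 → deg i + (0, (k : ℤ)) = d}
  zero_mem' := fun i k hk => (hk (Polynomial.coeff_zero k)).elim
  add_mem' := fun {p q} hp hq i k hk => by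
    by_cases h : (p i).coeff k = 0
    · exact hq i k fun h' => hk (by rw [Pi.add_apply, Polynomial.coeff_add, h, h', add_zero])
    · exact hp i k h
  neg_mem' := fun {p} hp i k hk => hp i k (by simpa using hk)

theorem freeGr_isInternal {ι : Type} [Fintype ι] [DecidableEq ι] (deg : ι → ℤ × ℤ) :
    DirectSum.IsInternal (freeGr deg) := by
  refine isInternal_of_separator
    (∑ i, (polySep (deg i) (AddMonoidHom.single (fun _ : ι => M2) i)).comp
      (Pi.evalAddMonoidHom (fun _ : ι => M2) i)) (fun d v hv => ?_) ?_
  · rw [AddMonoidHom.finsetSum_apply]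
    conv_rhs => rw [← Finset.univ_sum_single v, ← Finsupp.singleAddHom_apply, map_sum]
    refine Finset.sum_congr rfl fun i _ => ?_
    exact polySep_eq _ _ d (v i) (hv i)
  · rw [eq_top_iff]
    rintro v -
    rw [← Finset.univ_sum_single v]
    refine AddSubgroup.sum_mem _ fun i _ => ?_
    rw [← Polynomial.sum_monomial_eq (v i), Polynomial.sum_def]
    have e := map_sum (AddMonoidHom.single (fun _ : ι => M2) i)
      (fun k => Polynomial.monomial k ((v i).coeff k)) (v i).support
    simp only [AddMonoidHom.single_apply] at e
    rw [e]
    refine AddSubgroup.sum_mem _ fun k _ => ?_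
    refine AddSubgroup.mem_iSup_of_mem (deg i + (0, (k : ℤ))) fun j l hl => ?_
    by_cases hj : j = i
    · subst hj
      rw [Pi.single_eq_same, Polynomial.coeff_monomial] at hl
      split_ifs at hl with h
      · rw [h]
      · exact (hl rfl).elim
    · rw [Pi.single_eq_of_ne hj] at hl
      exact (hl (Polynomial.coeff_zero l)).elim

theorem coeff_tau_smul {p : M2} {k : ℕ} (h : (tau • p).coeff k ≠ 0) :
    ∃ l, k = l + 1 ∧ p.coeff l ≠ 0 := by
  obtain _ | k := k
  · simp at h
  · rw [smul_eq_mul, Polynomial.coeff_X_mul] at h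
    exact ⟨k, rfl, h⟩

/-- The unit module `M2`, with trivial action of `Sq¹`, `Sq²` and with `τᵏ` in bidegree `(0,k)`. -/
def unit : A1Mod where
  carrier := M2
  act := trivialAct M2
  gr d :=
    { carrier := {p | ∀ k : ℕ, p.coeff k ≠ 0 → ((0, (k : ℤ)) : ℤ × ℤ) = d}
      zero_mem' := fun k hk => (hk (Polynomial.coeff_zero k)).elim
      add_mem' := fun {p q} hp hq k hk => by
        by_cases h : p.coeff k = 0
        · exact hq k fun h' => hk (by rw [Polynomial.coeff_add, h, h', add_zero])
        · exact hp k h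
      neg_mem' := fun {p} hp k hk => hp k (by simpa using hk) }
  isInternal := by
    refine isInternal_of_separator (polySep 0 (AddMonoidHom.id M2)) (fun d p hp => ?_) ?_
    · exact polySep_eq _ _ d p fun k hk => by rw [zero_add, hp k hk]
    · rw [eq_top_iff]
      rintro p -
      rw [← Polynomial.sum_monomial_eq p, Polynomial.sum_def]
      refine AddSubgroup.sum_mem _ fun k _ => ?_
      refine AddSubgroup.mem_iSup_of_mem (0, (k : ℤ)) fun l hl => ?_
      rw [Polynomial.coeff_monomial] at hl
      split_ifs at hl with h
      · rw [h]
      · exact (hl rfl).elim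
  tau_mem d p hp k hk := by
    obtain ⟨l, rfl, hl⟩ := coeff_tau_smul hk
    rw [← hp l hl]
    simp
  sq1_mem d p hp := by rw [trivialAct_sq1]; exact AddSubgroup.zero_mem _
  sq2_mem d p hp := by rw [trivialAct_sq2]; exact AddSubgroup.zero_mem _
  finite := inferInstance
  free := inferInstance

theorem mem_unit_gr {d : ℤ × ℤ} {p : M2} :
    p ∈ unit.gr d ↔ ∀ k : ℕ, p.coeff k ≠ 0 → ((0, (k : ℤ)) : ℤ × ℤ) = d := Iff.rfl

/-! #### Coherence isomorphisms -/

theorem smul_unit_mem {M : A1Mod} {i j d : ℤ × ℤ} (h : i + j = d) {p : M2} {x : M.carrier}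
    (hp : p ∈ unit.gr i) (hx : x ∈ M.gr j) : p • x ∈ M.gr d := by
  rw [← Polynomial.sum_monomial_eq p, Polynomial.sum_def, Finset.sum_smul]
  refine AddSubgroup.sum_mem _ fun k hk => ?_
  have hi := hp k (Polynomial.mem_support_iff.1 hk)
  have hc : Polynomial.monomial k (p.coeff k) = (tau ^ k : M2) := by
    have : ∀ c : ZMod 2, c ≠ 0 → c = 1 := by decide
    rw [this _ (Polynomial.mem_support_iff.1 hk), Polynomial.monomial_one_right_eq_X_pow]
  have ht : ∀ (k : ℕ), (tau ^ k : M2) • x ∈ M.gr (j + (0, (k : ℤ))) := by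
    intro k
    induction k with
    | zero =>
      have h0 : j + (0, ((0 : ℕ) : ℤ)) = j := by ext <;> simp
      rwa [h0, pow_zero, one_smul]
    | succ k ih =>
      rw [pow_succ', mul_smul]
      have := M.tau_mem _ _ ih
      rw [add_assoc] at this
      simpa using this
  rw [hc, ← h, ← hi, add_comm]
  exact ht k

/-- `M2 ⊗ M ≅ M`. -/
def leftUnitor (M : A1Mod) : unit.tensor M ≅ M :=
  mkIso (M := unit.tensor M) (TensorProduct.lid M2 M.carrier)
    (fun z => lid_tensorAct_sq1 M.act z)
    (fun z => lid_tensorAct_sq2 M.act z)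
    (fun d => tensorGr_map (M := unit) (TensorProduct.lid M2 M.carrier).toLinearMap.toAddMonoidHom
      d _ fun i j hij p hp x hx => smul_unit_mem hij hp hx)
    (fun d x hx => by
      refine tmul_mem_tensorGr (M := unit) (zero_add d) (fun k hk => ?_) hx
      rw [Polynomial.coeff_one] at hk
      split_ifs at hk with h
      · rw [h]; rfl
      · exact (hk rfl).elim)

/-- `M ⊗ N ≅ N ⊗ M`. -/
def braiding (M N : A1Mod) : M.tensor N ≅ N.tensor M :=
  mkIso (M := M.tensor N) (N := N.tensor M) (TensorProduct.comm M2 M.carrier N.carrier)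
    (fun z => comm_tensorAct_sq1 M.act N.act z)
    (fun z => comm_tensorAct_sq2 M.act N.act z)
    (fun d => tensorGr_map (TensorProduct.comm M2 M.carrier N.carrier).toLinearMap.toAddMonoidHom
      d _ fun i j hij x hx y hy => tmul_mem_tensorGr (by rw [add_comm, hij]) hy hx)
    (fun d => tensorGr_map
      (TensorProduct.comm M2 M.carrier N.carrier).symm.toLinearMap.toAddMonoidHom
      d _ fun i j hij x hx y hy => tmul_mem_tensorGr (by rw [add_comm, hij]) hy hx)

/-- `(M ⊗ N) ⊗ P ≅ M ⊗ (N ⊗ P)`. -/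
def associator (M N P : A1Mod) : (M.tensor N).tensor P ≅ M.tensor (N.tensor P) :=
  mkIso (M := (M.tensor N).tensor P) (N := M.tensor (N.tensor P))
    (TensorProduct.assoc M2 M.carrier N.carrier P.carrier)
    (fun z => assoc_tensorAct_sq1 M.act N.act P.act z)
    (fun z => assoc_tensorAct_sq2 M.act N.act P.act z)
    (fun d => tensorGr_map (M := M.tensor N)
      (TensorProduct.assoc M2 M.carrier N.carrier P.carrier).toLinearMap.toAddMonoidHom
      d _ fun i k hik w hw z hz => by
        refine tensorGr_map (((TensorProduct.assoc M2 M.carrier N.carrier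
          P.carrier).toLinearMap.comp ((TensorProduct.mk M2 _ P.carrier).flip z)).toAddMonoidHom)
          i _ (fun i' j hij x hx y hy => ?_) w hw
        exact tmul_mem_tensorGr (N := N.tensor P) (by rw [← hik, ← hij, add_assoc]) hx
          (tmul_mem_tensorGr rfl hy hz))
    (fun d => tensorGr_map (N := N.tensor P)
      (TensorProduct.assoc M2 M.carrier N.carrier P.carrier).symm.toLinearMap.toAddMonoidHom
      d _ fun i k hik x hx w hw => by
        refine tensorGr_map (((TensorProduct.assoc M2 M.carrier N.carrier
          P.carrier).symm.toLinearMap.comp (TensorProduct.mk M2 M.carrier _ x)).toAddMonoidHom)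
          k _ (fun j k' hjk y hy z hz => ?_) w hw
        exact tmul_mem_tensorGr (M := M.tensor N) (by rw [← hik, ← hjk, add_assoc])
          (tmul_mem_tensorGr rfl hx hy) hz)

/-! #### The joker -/

/-- `Sq¹` on the joker, in the basis `x, Sq¹x, y, Sq²Sq¹x, Sq²y`. -/
def jokerSq1 : Module.End M2 (Fin 5 → M2) where
  toFun v := ![0, v 0, 0, 0, v 3]
  map_add' v w := by ext1 i; fin_cases i <;> simp
  map_smul' r v := by ext1 i; fin_cases i <;> simp

/-- `Sq²` on the joker, in the basis `x, Sq¹x, y, Sq²Sq¹x, Sq²y`. -/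
def jokerSq2 : Module.End M2 (Fin 5 → M2) where
  toFun v := ![0, 0, tau * v 0, v 1, v 2]
  map_add' v w := by ext1 i; fin_cases i <;> simp [mul_add]
  map_smul' r v := by ext1 i; fin_cases i <;> simp [mul_left_comm]

/-- The action of `𝒜(1)` on the joker. -/
def jokerAct : A1 →ₐ[M2] Module.End M2 (Fin 5 → M2) :=
  A1.lift jokerSq1 jokerSq2
    (by refine LinearMap.ext fun v => funext fun i => ?_; fin_cases i <;> simp [jokerSq1])
    (by refine LinearMap.ext fun v => funext fun i => ?_; fin_cases i <;> simp [jokerSq1, jokerSq2])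
    (by refine LinearMap.ext fun v => funext fun i => ?_; fin_cases i <;> simp [jokerSq1, jokerSq2])

theorem jokerAct_sq1 (v : Fin 5 → M2) : jokerAct sq1 v = ![0, v 0, 0, 0, v 3] := by
  rw [jokerAct, A1.lift_sq1]; rfl

theorem jokerAct_sq2 (v : Fin 5 → M2) : jokerAct sq2 v = ![0, 0, tau * v 0, v 1, v 2] := by
  rw [jokerAct, A1.lift_sq2]; rfl

/-- The motivic joker `J`: the `𝒜(1)`-module on generators `x` of bidegree `(0,0)` and `y` of
bidegree `(2,0)` with relations `Sq²x = τy`, `Sq¹Sq²Sq¹x = Sq²y`, `Sq¹y = 0`. It is written in its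
`M2`-basis `x, Sq¹x, y, Sq²Sq¹x, Sq²y`; that it has the stated presentation is
`joker_relations` and `joker_universal`. -/
def joker : A1Mod where
  carrier := Fin 5 → M2
  act := jokerAct
  gr := freeGr ![(0, 0), (1, 0), (2, 0), (3, 1), (4, 1)]
  isInternal := freeGr_isInternal _
  tau_mem d v hv i k hk := by
    obtain ⟨l, rfl, hl⟩ := coeff_tau_smul hk
    rw [← hv i l hl]
    push_cast
    rw [add_assoc]
    simp
  sq1_mem d v hv i k hk := by
    rw [jokerAct_sq1] at hk
    fin_cases i
    · simp at hk
    · rw [← hv 0 k hk]; ext <;> simp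
    · simp at hk
    · simp at hk
    · rw [← hv 3 k hk]; ext <;> simp
  sq2_mem d v hv i k hk := by
    rw [jokerAct_sq2] at hk
    fin_cases i
    · simp at hk
    · simp at hk
    · obtain ⟨l, rfl, hl⟩ := coeff_tau_smul hk
      rw [← hv 0 l hl]; ext <;> simp
    · rw [← hv 1 k hk]; ext <;> simp; ring
    · rw [← hv 2 k hk]; ext <;> simp; ring
  finite := inferInstance
  free := inferInstance

/-- The generator `x`. -/
def jokerX : Fin 5 → M2 := Pi.single 0 1

/-- The generator `y`. -/
def jokerY : Fin 5 → M2 := Pi.single 2 1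

end A1Mod

namespace A1Mod

theorem jokerX_mem : jokerX ∈ joker.gr (0, 0) := by
  intro i k hk
  by_cases hi : i = 0
  · subst hi
    rw [jokerX, Pi.single_eq_same, Polynomial.coeff_one] at hk
    split_ifs at hk with h
    · subst h; ext <;> simp
    · exact (hk rfl).elim
  · rw [jokerX, Pi.single_eq_of_ne hi] at hk
    exact (hk (Polynomial.coeff_zero k)).elim

theorem jokerY_mem : jokerY ∈ joker.gr (2, 0) := by
  intro i k hk
  by_cases hi : i = 2
  · subst hi
    rw [jokerY, Pi.single_eq_same, Polynomial.coeff_one] at hk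
    split_ifs at hk with h
    · subst h; ext <;> simp
    · exact (hk rfl).elim
  · rw [jokerY, Pi.single_eq_of_ne hi] at hk
    exact (hk (Polynomial.coeff_zero k)).elim

/-- The defining relations hold in `J`. -/
theorem joker_relations : jokerAct sq2 jokerX = tau • jokerY ∧
    jokerAct (sq1 * sq2 * sq1) jokerX = jokerAct sq2 jokerY ∧ jokerAct sq1 jokerY = 0 := by
  refine ⟨?_, ?_, ?_⟩
  · rw [jokerX, jokerY, jokerAct_sq2]
    refine funext fun i => ?_
    fin_cases i <;> simp
  · rw [map_mul, map_mul, Module.End.mul_apply, Module.End.mul_apply, jokerX, jokerY,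
      jokerAct_sq1, jokerAct_sq2, jokerAct_sq1, jokerAct_sq2]
    refine funext fun i => ?_
    fin_cases i <;> simp
  · rw [jokerY, jokerAct_sq1]
    refine funext fun i => ?_
    fin_cases i <;> simp

/-- `J` is the universal `𝒜(1)`-module with two elements `x`, `y` satisfying the defining
relations. -/
theorem joker_universal (V : Type*) [AddCommGroup V] [Module M2 V] [Module A1 V]
    [IsScalarTower M2 A1 V] (x y : V) (h1 : sq2 • x = tau • y)
    (h2 : (sq1 * sq2 * sq1) • x = sq2 • y) (h3 : sq1 • y = 0) :
    ∃! f : ActMod jokerAct →ₗ[A1] V,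
      f (ActMod.of jokerAct jokerX) = x ∧ f (ActMod.of jokerAct jokerY) = y := by
  have c1 : ∀ (a : A1) (r : M2) (z : V), a • r • z = r • a • z := fun a r z => by
    rw [← algebraMap_smul A1 r z, ← mul_smul, ← Algebra.commutes, mul_smul, algebraMap_smul]
  have e11 : ∀ z : V, sq1 • sq1 • z = 0 := fun z => by rw [← mul_smul, sq1_sq1, zero_smul]
  have e22 : ∀ z : V, sq2 • sq2 • z = tau • sq1 • sq2 • sq1 • z := fun z => by
    rw [← mul_smul, sq2_sq2, smul_assoc, mul_smul, mul_smul]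
  rw [mul_smul, mul_smul] at h2
  have h4 : sq1 • sq2 • y = 0 := by rw [← h2, e11]
  let g : (Fin 5 → M2) →ₗ[M2] V :=
    { toFun := fun v => v 0 • x + v 1 • sq1 • x + v 2 • y + v 3 • sq2 • sq1 • x + v 4 • sq2 • y
      map_add' := fun v w => by simp only [Pi.add_apply, add_smul]; abel
      map_smul' := fun r v => by
        simp only [Pi.smul_apply, smul_eq_mul, mul_smul, smul_add, RingHom.id_apply] }
  have hg : ∀ v, g v =
      v 0 • x + v 1 • sq1 • x + v 2 • y + v 3 • sq2 • sq1 • x + v 4 • sq2 • y := fun v => rfl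
  have act := map_act_of_generators (ρ := jokerAct)
    (σ := Algebra.lsmul M2 M2 V) g
    (fun v => by
      rw [jokerAct_sq1]
      change g _ = sq1 • g v
      simp only [hg, smul_add, c1, e11, h3, h2, h4]
      simp)
    (fun v => by
      rw [jokerAct_sq2]
      change g _ = sq2 • g v
      simp only [hg, smul_add, c1, e11, e22, h3, h1]
      simp [mul_smul, smul_comm tau])
  refine ⟨{ toFun := fun v => g ((ActMod.of jokerAct).symm v)
            map_add' := fun v w => by rw [map_add, map_add]
            map_smul' := fun a v => ?_ }, ⟨?_, ?_⟩, fun f hf => ?_⟩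
  · obtain ⟨v, rfl⟩ := (ActMod.of jokerAct).surjective v
    exact act a v
  · change g (Pi.single 0 1) = x
    simp [hg]
  · change g (Pi.single 2 1) = y
    simp [hg]
  · obtain ⟨hfx, hfy⟩ := hf
    ext v
    obtain ⟨v, rfl⟩ := (ActMod.of jokerAct).surjective v
    change f (ActMod.of jokerAct v) = g v
    have hs : ∀ (r : M2) (z : ActMod jokerAct), f (r • z) = r • f z := fun r z => by
      rw [← algebraMap_smul A1 r z, map_smul, algebraMap_smul]
    have hv : ActMod.of jokerAct v = v 0 • ActMod.of jokerAct jokerX +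
        v 1 • sq1 • ActMod.of jokerAct jokerX + v 2 • ActMod.of jokerAct jokerY +
        v 3 • sq2 • sq1 • ActMod.of jokerAct jokerX + v 4 • sq2 • ActMod.of jokerAct jokerY := by
      simp only [ActMod.smul_of, ← map_smul, ← map_add]
      refine congrArg (ActMod.of jokerAct) ?_
      simp only [jokerX, jokerY, jokerAct_sq1, jokerAct_sq2]
      refine funext fun i => ?_
      simp only [Pi.add_apply, Pi.smul_apply, smul_eq_mul]
      fin_cases i <;> simp
    rw [hv]
    simp only [map_add, hs, map_smul, hfx, hfy, hg]

end A1Mod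

/-! ### The stable category and the Picard group -/

/-- The stable category of `𝒜(1)`: bigraded finitely generated `𝒜(1)`-modules that are free over
`M2`, with homomorphisms modulo those that factor through a projective module. -/
abbrev Stab : Type 1 := CategoryTheory.Quotient A1Mod.StablyEq

/-- The functor from modules to the stable category. -/
abbrev toStab : A1Mod ⥤ Stab := CategoryTheory.Quotient.functor A1Mod.StablyEq

namespace A1Mod

/-- Two modules are stably equivalent if they are isomorphic in the stable category. -/
def StablyIso (M N : A1Mod) : Prop := Nonempty (toStab.obj M ≅ toStab.obj N)

theorem StablyIso.of_iso {M N : A1Mod} (e : M ≅ N) : StablyIso M N := ⟨toStab.mapIso e⟩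

theorem StablyIso.symm {M N : A1Mod} (h : StablyIso M N) : StablyIso N M :=
  h.elim fun e => ⟨e.symm⟩

theorem StablyIso.trans {M N P : A1Mod} (h : StablyIso M N) (h' : StablyIso N P) :
    StablyIso M P :=
  h.elim fun e => h'.elim fun e' => ⟨e ≪≫ e'⟩

theorem IsProjective.tensor {M : A1Mod} (h : M.IsProjective) (N : A1Mod) :
    (M.tensor N).IsProjective := projective_tensorAct M.act N.act h

/-- Tensoring with `N` on the right. -/
def tensorRight (N : A1Mod) : A1Mod ⥤ A1Mod where
  obj M := M.tensor N
  map f := tensorHom f (𝟙 N)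
  map_id M := hom_ext (TensorProduct.map_id)
  map_comp f g := hom_ext (by
    change TensorProduct.map (g.toLin.comp f.toLin) LinearMap.id = _
    exact TensorProduct.map_comp g.toLin LinearMap.id f.toLin LinearMap.id)

theorem StablyEq.tensorRight {M M' : A1Mod} {f g : M ⟶ M'} (h : StablyEq f g) (N : A1Mod) :
    StablyEq ((tensorRight N).map f) ((tensorRight N).map g) := by
  obtain ⟨P, u, v, hP, e⟩ := h
  refine ⟨P.tensor N, (A1Mod.tensorRight N).map u, (A1Mod.tensorRight N).map v, hP.tensor N, ?_⟩
  change _ = ((A1Mod.tensorRight N).map u ≫ (A1Mod.tensorRight N).map v :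
    (A1Mod.tensorRight N).obj M ⟶ (A1Mod.tensorRight N).obj M').toLin
  rw [← Functor.map_comp]
  change TensorProduct.map f.toLin LinearMap.id - TensorProduct.map g.toLin LinearMap.id =
    TensorProduct.map (u ≫ v).toLin LinearMap.id
  rw [← e]
  exact TensorProduct.ext' fun x y => (TensorProduct.sub_tmul (f.toLin x) (g.toLin x) y).symm

theorem StablyIso.tensor_right {M M' : A1Mod} (h : StablyIso M M') (N : A1Mod) :
    StablyIso (M.tensor N) (M'.tensor N) :=
  h.elim fun e => ⟨(CategoryTheory.Quotient.lift StablyEq (tensorRight N ⋙ toStab)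
    fun _ _ _ _ h => CategoryTheory.Quotient.sound _ (h.tensorRight N)).mapIso e⟩

theorem StablyIso.tensor {M M' N N' : A1Mod} (h : StablyIso M M') (h' : StablyIso N N') :
    StablyIso (M.tensor N) (M'.tensor N') :=
  (h.tensor_right N).trans <| (StablyIso.of_iso (braiding M' N)).trans <|
    (h'.tensor_right M').trans (StablyIso.of_iso (braiding N' M'))

/-- Stable equivalence of modules. -/
instance stableSetoid : Setoid A1Mod where
  r := StablyIso
  iseqv := ⟨fun M => StablyIso.of_iso (Iso.refl M), StablyIso.symm, StablyIso.trans⟩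

/-- The tensor powers of a module. -/
def tensorPow (M : A1Mod) : ℕ → A1Mod
  | 0 => unit
  | n + 1 => (tensorPow M n).tensor M

/-- A module is (stably) invertible if some module is inverse to it under the tensor product, up to
stable equivalence. -/
def IsInvertible (M : A1Mod) : Prop := ∃ N : A1Mod, StablyIso (M.tensor N) unit

end A1Mod

/-- Stable equivalence classes of modules. -/
def StabClass : Type 1 := _root_.Quotient A1Mod.stableSetoid

namespace StabClass

/-- The class of a module. -/
def mk (M : A1Mod) : StabClass := Quotient.mk'' M

theorem mk_eq_mk {M N : A1Mod} : mk M = mk N ↔ A1Mod.StablyIso M N := Quotient.eq''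

/-- Stable equivalence classes form a commutative monoid under the tensor product. -/
instance : CommMonoid StabClass where
  mul := Quotient.map₂ A1Mod.tensor fun _ _ h _ _ h' => A1Mod.StablyIso.tensor h h'
  one := mk A1Mod.unit
  mul_assoc := by
    rintro ⟨M⟩ ⟨N⟩ ⟨P⟩
    exact mk_eq_mk.2 (.of_iso (A1Mod.associator M N P))
  one_mul := by
    rintro ⟨M⟩
    exact mk_eq_mk.2 (.of_iso (A1Mod.leftUnitor M))
  mul_one := by
    rintro ⟨M⟩
    exact mk_eq_mk.2 (.of_iso (A1Mod.braiding M _ ≪≫ A1Mod.leftUnitor M))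
  mul_comm := by
    rintro ⟨M⟩ ⟨N⟩
    exact mk_eq_mk.2 (.of_iso (A1Mod.braiding M N))

theorem mk_tensor (M N : A1Mod) : mk (M.tensor N) = mk M * mk N := rfl

theorem mk_unit : mk A1Mod.unit = 1 := rfl

theorem mk_tensorPow (M : A1Mod) (n : ℕ) : mk (M.tensorPow n) = mk M ^ n := by
  induction n with
  | zero => rw [pow_zero]; rfl
  | succ n ih => rw [pow_succ, ← ih]; rfl

end StabClass

/-- The Picard group of `𝒜(1)`: the group of invertible stable equivalence classes, under the tensor
product. -/
abbrev Pic : Type 1 := StabClassˣ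

/-- The class in the Picard group of an invertible module. -/
def Pic.mk (M : A1Mod) (h : M.IsInvertible) : Pic :=
  Units.mkOfMulEqOne (StabClass.mk M) (StabClass.mk h.choose)
    (StabClass.mk_eq_mk.2 h.choose_spec)

theorem Pic.val_mk (M : A1Mod) (h : M.IsInvertible) : (Pic.mk M h : StabClass) = StabClass.mk M :=
  rfl

/-! ### Margolis homology modulo `τ` -/

namespace A1Mod

/-- The quotient `M/τ = M/τM`. -/
abbrev ModTau (M : A1Mod) : Type :=
  M.carrier ⧸ LinearMap.range (LinearMap.lsmul M2 M.carrier tau)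

/-- The action of `𝒜(1)` on `M/τ`. -/
def modTauAct (M : A1Mod) (a : A1) : Module.End M2 M.ModTau :=
  Submodule.mapQ _ _ (M.act a) (by
    rintro _ ⟨x, rfl⟩
    exact ⟨M.act a x, by simp⟩)

/-- The bigrading of `M/τ`. -/
def modTauGr (M : A1Mod) (d : ℤ × ℤ) : AddSubgroup M.ModTau :=
  (M.gr d).map (Submodule.mkQ (LinearMap.range (LinearMap.lsmul M2 M.carrier tau))).toAddMonoidHom

/-- The Margolis homology `H(M/τ; a)`: the annihilator of `a` in `M/τ` modulo the image of `a`. -/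
abbrev Margolis (M : A1Mod) (a : A1) : Type :=
  LinearMap.ker (M.modTauAct a) ⧸
    (LinearMap.range (M.modTauAct a)).submoduleOf (LinearMap.ker (M.modTauAct a))

/-- The part of `H(M/τ; a)` of bidegree `d`: the classes of the homogeneous elements of
bidegree `d`. -/
def margolisGr (M : A1Mod) (a : A1) (d : ℤ × ℤ) : AddSubgroup (M.Margolis a) :=
  ((M.modTauGr d).comap (LinearMap.ker (M.modTauAct a)).subtype.toAddMonoidHom).map
    (Submodule.mkQ ((LinearMap.range (M.modTauAct a)).submoduleOf
      (LinearMap.ker (M.modTauAct a)))).toAddMonoidHom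

end A1Mod

end

end MotivicA1

/-!
The proof makes three computations over `M2 = 𝔽₂[τ]`.

*Invertibility.* The inverse of the joker `J` is its `M2`-linear dual `DJ` (`dualJoker`), a cyclic
module on a generator `a` of bidegree `(-4,-1)`. As `J` has odd rank `5`, the canonical invariant
element of `J ⊗ DJ` spans a summand `M2`, and the complement, of rank `24`, turns out to be free of
rank three over `𝒜(1)`, on `x ⊗ a`, `Sq¹x ⊗ a` and `y ⊗ a`. Concretely, the homomorphism `splitting`
from `M2 ⊕ 𝒜(1)³` given by these four elements is onto, because the `𝒜(1)`-submodule that they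
generate contains all products of basis elements (`eq_top_of_stable`); both sides are free of rank
`25` over `M2`, so it is bijective, and bijective homomorphisms are isomorphisms of bigraded modules
(`isoOfBijective`). Projective summands are invisible in the stable category (`stablyIso_prod`).

*Margolis homology.* Modulo `τ` the elements `Sq¹` and `Sq²` are differentials on every module and
derivations on tensor products. A contraction of each factor onto one homology class yields a
contraction of the tensor product (`HasMargolisRetract.tensor`). On `J` the class `x` of bidegree
`(0,0)` carries the `Sq²`-homology and the class `y` of bidegree `(2,0)` carries the `Sq¹`-homology,
so on the `n`-th tensor power the bidegrees are `(0,0)` and `(2n,0)`.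

*Infinite order.* `Sq¹`-cycles in a projective module are boundaries (`IsProjective.exists_sq1`),
since left multiplication by `Sq¹` on `𝒜(1)` is contractible. Hence a stable equivalence with the
unit forces the `Sq¹`-homology modulo `τ` into bidegree `0`
(`HasMargolisRetract.eq_zero_of_stablyIso`), which fails for `(2n,0)` with `n ≥ 1`.
-/

namespace MotivicA1

noncomputable section

open A1 CategoryTheory

/-! ### The monomial basis of `𝒜(1)` -/

namespace A1

theorem linearIndependent_mono : LinearIndependent M2 mono := by
  rw [Fintype.linearIndependent_iff]
  intro c hc t
  have h := congrFun (congrFun (congrArg (fun a => Steenrod.rep (toSteenrod a)) hc) t) 0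
  simp only [map_sum, map_smul, map_zero, Matrix.sum_apply, Matrix.smul_apply, rep_mono,
    smul_eq_mul, mul_ite, mul_zero, Finset.sum_ite_eq, Finset.mem_univ, if_true,
    Matrix.zero_apply] at h
  exact (mul_eq_zero.1 h).resolve_right (pow_ne_zero _ Polynomial.X_ne_zero)

/-- The basis of `𝒜(1)` over `M2` that consists of the monomials `mono`. -/
def monoBasis : Module.Basis (Fin 8) M2 A1 :=
  Module.Basis.mk linearIndependent_mono span_mono.ge

@[simp] theorem monoBasis_apply (i : Fin 8) : monoBasis i = mono i := by
  simp [monoBasis]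

/-- The contraction of left multiplication by `Sq¹` on `𝒜(1)`: it removes a leading `Sq¹` from a
monomial and kills the monomials that do not start with `Sq¹`. -/
def contract : A1 →ₗ[M2] A1 :=
  monoBasis.constr M2 ![0, 1, 0, sq2, 0, sq2 * sq1, 0, sq2 * sq1 * sq2]

theorem contract_mono (i : Fin 8) :
    contract (mono i) = ![0, 1, 0, sq2, 0, sq2 * sq1, 0, sq2 * sq1 * sq2] i := by
  rw [← monoBasis_apply, contract, Module.Basis.constr_basis]

theorem contract_homotopy (a : A1) : sq1 * contract a + contract (sq1 * a) = a := by
  have h : (LinearMap.mulLeft M2 sq1).comp contract + contract.comp (LinearMap.mulLeft M2 sq1) =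
      LinearMap.id := by
    refine monoBasis.ext fun i => ?_
    simp only [monoBasis_apply, LinearMap.add_apply, LinearMap.comp_apply,
      LinearMap.mulLeft_apply, LinearMap.id_apply, contract_mono]
    have e : ∀ x : A1, sq1 * (sq1 * x) = 0 := fun x => by rw [← mul_assoc, sq1_sq1, zero_mul]
    have c1 := contract_mono 1
    have c3 := contract_mono 3
    have c5 := contract_mono 5
    have c7 := contract_mono 7
    simp only [mono] at c1 c3 c5 c7
    fin_cases i
    · simpa [mono] using c1
    · simp [mono, sq1_sq1]
    · simpa [mono] using c3
    · simp [mono, e]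
    · simpa [mono, mul_assoc] using c5
    · simp [mono, e, mul_assoc]
    · simpa [mono, mul_assoc] using c7
    · simp [mono, e, mul_assoc]
  exact LinearMap.congr_fun h a

end A1

namespace A1Mod

/-- A projective module has no `Sq¹`-homology, even before reduction modulo `τ`. -/
theorem IsProjective.exists_sq1 {P : A1Mod} (hP : P.IsProjective) {p : P.carrier}
    (hp : P.act sq1 p = 0) : ∃ q, P.act sq1 q = p := by
  obtain ⟨s, hs⟩ := Module.projective_def'.1 hP
  have h0 : sq1 • s (ActMod.of P.act p) = 0 := by
    rw [← map_smul, ActMod.smul_of, hp, map_zero, map_zero]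
  have h1 : s (ActMod.of P.act p) =
      sq1 • (s (ActMod.of P.act p)).mapRange contract (map_zero contract) := by
    ext i
    have hi := DFunLike.congr_fun h0 i
    rw [Finsupp.smul_apply, smul_eq_mul, Finsupp.zero_apply] at hi
    have := contract_homotopy (s (ActMod.of P.act p) i)
    rw [hi, map_zero, add_zero] at this
    simpa using this.symm
  have h2 := LinearMap.congr_fun hs (ActMod.of P.act p)
  rw [LinearMap.comp_apply, h1, map_smul] at h2
  exact ⟨_, h2⟩

/-! ### Free modules of rank one -/

theorem isInternal_comap {X Y : Type*} [AddCommGroup X] [AddCommGroup Y] (e : X ≃+ Y)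
    {gr : ℤ × ℤ → AddSubgroup Y} (h : DirectSum.IsInternal gr) :
    DirectSum.IsInternal fun d => (gr d).comap e.toAddMonoidHom := by
  obtain ⟨D, hD⟩ := exists_separator h
  refine isInternal_of_separator ((Finsupp.mapRange.addMonoidHom e.symm.toAddMonoidHom).comp
    (D.comp e.toAddMonoidHom)) (fun d x hx => ?_) ?_
  · have := hD d (e x) hx
    simp [this]
  · rw [eq_top_iff]
    rintro x -
    obtain ⟨y, rfl⟩ := e.symm.surjective x
    induction y using homogeneous_induction h with
    | hom d y hy =>
      refine AddSubgroup.mem_iSup_of_mem d ?_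
      simpa using hy
    | add y z hy hz => rw [map_add]; exact AddSubgroup.add_mem _ hy hz

/-- The bidegrees of the monomials `mono`. -/
def monoDeg : Fin 8 → ℤ × ℤ :=
  ![(0, 0), (1, 0), (2, 1), (3, 1), (3, 1), (4, 1), (5, 2), (6, 2)]

/-- The bigrading of `𝒜(1)` in which `1` has bidegree `d`. -/
def shiftGr (d k : ℤ × ℤ) : AddSubgroup A1 :=
  (freeGr (fun i => d + monoDeg i) k).comap monoBasis.equivFun.toAddEquiv.toAddMonoidHom

theorem mem_shiftGr {d k : ℤ × ℤ} {a : A1} : a ∈ shiftGr d k ↔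
    ∀ i, ∀ l : ℕ, (monoBasis.equivFun a i).coeff l ≠ 0 → d + monoDeg i + (0, (l : ℤ)) = k :=
  Iff.rfl

theorem mono_mem_shiftGr (d : ℤ × ℤ) (i : Fin 8) : mono i ∈ shiftGr d (d + monoDeg i) := by
  rw [mem_shiftGr]
  intro j l hl
  rw [← monoBasis_apply, Module.Basis.equivFun_self] at hl
  split_ifs at hl with h
  · rw [Polynomial.coeff_one] at hl
    split_ifs at hl with h'
    · subst h h'; ext <;> simp
    · exact (hl rfl).elim
  · exact (hl (Polynomial.coeff_zero l)).elim

theorem tau_smul_mem_shiftGr (d k : ℤ × ℤ) (a : A1) (ha : a ∈ shiftGr d k) :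
    tau • a ∈ shiftGr d (k + (0, 1)) := by
  rw [mem_shiftGr] at ha ⊢
  intro i l hl
  rw [map_smul, Pi.smul_apply] at hl
  obtain ⟨m, rfl, hm⟩ := coeff_tau_smul hl
  rw [← ha i m hm]
  ext <;> simp [add_assoc]

theorem smul_mem_of_tau {V : Type*} [AddCommGroup V] [Module M2 V] {gr : ℤ × ℤ → AddSubgroup V}
    (htau : ∀ d, ∀ x ∈ gr d, tau • x ∈ gr (d + (0, 1))) {e d : ℤ × ℤ} {p : M2} {x : V}
    (hp : ∀ k : ℕ, p.coeff k ≠ 0 → e + (0, (k : ℤ)) = d) (hx : x ∈ gr e) : p • x ∈ gr d := by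
  have ht : ∀ k : ℕ, (tau ^ k : M2) • x ∈ gr (e + (0, (k : ℤ))) := by
    intro k
    induction k with
    | zero => simpa [← Prod.zero_eq_mk] using hx
    | succ k ih =>
      rw [pow_succ', mul_smul]
      have := htau _ _ ih
      rw [add_assoc] at this
      simpa using this
  rw [← Polynomial.sum_monomial_eq p, Polynomial.sum_def, Finset.sum_smul]
  refine AddSubgroup.sum_mem _ fun k hk => ?_
  have hk' := Polynomial.mem_support_iff.1 hk
  have hc : p.coeff k = 1 := by
    have : ∀ c : ZMod 2, c ≠ 0 → c = 1 := by decide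
    exact this _ hk'
  rw [hc, Polynomial.monomial_one_right_eq_X_pow, ← hp k hk']
  exact ht k

/-- A linear map out of `𝒜(1)` has bidegree `s` as soon as this holds on monomials. -/
theorem map_mem_of_mono {V : Type*} [AddCommGroup V] [Module M2 V] {gr : ℤ × ℤ → AddSubgroup V}
    (htau : ∀ d, ∀ x ∈ gr d, tau • x ∈ gr (d + (0, 1))) {d s : ℤ × ℤ} (f : A1 →ₗ[M2] V)
    (hf : ∀ i, f (mono i) ∈ gr (d + monoDeg i + s)) (k : ℤ × ℤ) (a : A1) (ha : a ∈ shiftGr d k) :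
    f a ∈ gr (k + s) := by
  rw [← monoBasis.sum_equivFun a, map_sum]
  refine AddSubgroup.sum_mem _ fun i _ => ?_
  rw [map_smul, monoBasis_apply]
  refine smul_mem_of_tau htau (fun l hl => ?_) (hf i)
  rw [← mem_shiftGr.1 ha i l hl, add_right_comm]

theorem sq1_mul_mono (i : Fin 8) :
    sq1 * mono i = ![mono 1, 0, mono 3, 0, mono 5, 0, mono 7, 0] i := by
  have e : ∀ x : A1, sq1 * (sq1 * x) = 0 := fun x => by rw [← mul_assoc, sq1_sq1, zero_mul]
  fin_cases i <;> simp [mono, mul_assoc, e, sq1_sq1]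

theorem sq2_mul_mono (i : Fin 8) :
    sq2 * mono i = ![mono 2, mono 4, tau • mono 5, mono 6, 0, mono 7, 0, 0] i := by
  have e : ∀ x : A1, sq1 * (sq1 * x) = 0 := fun x => by rw [← mul_assoc, sq1_sq1, zero_mul]
  have e2 : ∀ x : A1, sq2 * (sq2 * x) = tau • (sq1 * (sq2 * (sq1 * x))) := fun x => by
    rw [← mul_assoc, sq2_sq2, smul_mul_assoc, mul_assoc, mul_assoc]
  have et : sq1 * (sq2 * (sq1 * sq2)) = sq2 * (sq1 * (sq2 * sq1)) := by
    simpa only [mul_assoc] using sq_top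
  fin_cases i <;> simp [mono, mul_assoc, e, e2, et, sq1_sq1, sq2_sq2]

/-- The free `𝒜(1)`-module on one generator of bidegree `d`. -/
def regular (d : ℤ × ℤ) : A1Mod where
  carrier := A1
  act := Algebra.lmul M2 A1
  gr := shiftGr d
  isInternal := isInternal_comap monoBasis.equivFun.toAddEquiv (freeGr_isInternal _)
  tau_mem := tau_smul_mem_shiftGr d
  sq1_mem := map_mem_of_mono (tau_smul_mem_shiftGr d) (LinearMap.mulLeft M2 sq1) fun i => by
    rw [LinearMap.mulLeft_apply, sq1_mul_mono]
    have h : ∀ j k, d + monoDeg j = k → mono j ∈ shiftGr d k := fun j k e =>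
      e ▸ mono_mem_shiftGr d j
    fin_cases i
    exacts [h 1 _ (by rw [add_assoc]; rfl), AddSubgroup.zero_mem _,
      h 3 _ (by rw [add_assoc]; rfl), AddSubgroup.zero_mem _,
      h 5 _ (by rw [add_assoc]; rfl), AddSubgroup.zero_mem _,
      h 7 _ (by rw [add_assoc]; rfl), AddSubgroup.zero_mem _]
  sq2_mem := map_mem_of_mono (tau_smul_mem_shiftGr d) (LinearMap.mulLeft M2 sq2) fun i => by
    rw [LinearMap.mulLeft_apply, sq2_mul_mono]
    have h : ∀ j k, d + monoDeg j = k → mono j ∈ shiftGr d k := fun j k e =>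
      e ▸ mono_mem_shiftGr d j
    fin_cases i
    exacts [h 2 _ (by rw [add_assoc]; rfl), h 4 _ (by rw [add_assoc]; rfl),
      cast (congrArg (tau • mono 5 ∈ shiftGr d ·) (by rw [add_assoc, add_assoc]; rfl))
        (tau_smul_mem_shiftGr d _ _ (h 5 _ rfl)),
      h 6 _ (by rw [add_assoc]; rfl), AddSubgroup.zero_mem _,
      h 7 _ (by rw [add_assoc]; rfl), AddSubgroup.zero_mem _, AddSubgroup.zero_mem _]
  finite := inferInstance
  free := Module.Free.of_basis monoBasis

theorem regular_isProjective (d : ℤ × ℤ) : (regular d).IsProjective := by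
  let e : A1 ≃ₗ[A1] ActMod (regular d).act :=
    { (ActMod.of (regular d).act).toAddEquiv with
      map_smul' := fun _ _ => rfl }
  exact Module.Projective.of_equiv e

theorem act_mono_mem {M : A1Mod} {d : ℤ × ℤ} {z : M.carrier} (hz : z ∈ M.gr d) (i : Fin 8) :
    M.act (mono i) z ∈ M.gr (d + monoDeg i) := by
  have key : ∀ {a b : A1} {e f g : ℤ × ℤ}, (∀ k, ∀ x ∈ M.gr k, M.act a x ∈ M.gr (k + e)) →
      (∀ k, ∀ x ∈ M.gr k, M.act b x ∈ M.gr (k + f)) → f + e = g →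
      ∀ k, ∀ x ∈ M.gr k, M.act (a * b) x ∈ M.gr (k + g) := by
    rintro a b e f _ ha hb rfl k x hx
    rw [map_mul, Module.End.mul_apply, ← add_assoc]
    exact ha _ _ (hb _ _ hx)
  have h1 := M.sq1_mem
  have h2 := M.sq2_mem
  have h12 := key h1 h2 rfl
  have h21 := key h2 h1 rfl
  have h121 := key h12 h1 rfl
  have h212 := key h21 h2 rfl
  have h1212 := key h121 h2 rfl
  fin_cases i
  · simpa [mono, monoDeg, ← Prod.zero_eq_mk] using hz
  · exact h1 d z hz
  · exact h2 d z hz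
  · exact h12 d z hz
  · exact h21 d z hz
  · exact h121 d z hz
  · exact h212 d z hz
  · exact h1212 d z hz

/-- The homomorphism `a ↦ a z` from a free module of rank one that is given by a homogeneous
element `z`. -/
def ofElement {M : A1Mod} {d : ℤ × ℤ} (z : M.carrier) (hz : z ∈ M.gr d) :
    regular d ⟶ M where
  toLin := (M.act.toLinearMap.flip z : A1 →ₗ[M2] M.carrier)
  map_act a (b : A1) := by
    change M.act (a * b) z = M.act a (M.act b z)
    rw [map_mul, Module.End.mul_apply]
  map_gr k a ha := by
    have := map_mem_of_mono (s := 0) M.tau_mem (M.act.toLinearMap.flip z)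
      (fun i => by rw [add_zero]; exact act_mono_mem hz i) k a ha
    rwa [add_zero] at this

end A1Mod

/-! ### Splitting off a projective summand -/

namespace A1Mod

/-- A homomorphism that is bijective is an isomorphism: the inverse preserves bidegrees
automatically. -/
def isoOfBijective {M N : A1Mod} (f : M ⟶ N) (hf : Function.Bijective f.toLin) : M ≅ N :=
  mkIso (LinearEquiv.ofBijective f.toLin hf) (fun x => f.map_act sq1 x) (fun x => f.map_act sq2 x)
    (fun d x hx => f.map_gr d x hx) (fun d y hy => by
      obtain ⟨x, rfl⟩ := (LinearEquiv.ofBijective f.toLin hf).surjective y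
      rw [LinearEquiv.symm_apply_apply]
      change f.toLin x ∈ N.gr d at hy
      obtain ⟨v, rfl⟩ := M.isInternal.2 x
      obtain ⟨E, hE⟩ := exists_separator N.isInternal
      have key : ∀ v : DirectSum (ℤ × ℤ) fun d => M.gr d, ∀ i,
          E (f.toLin (DirectSum.coeAddMonoidHom M.gr v)) i = f.toLin (v i) := by
        intro v i
        induction v using DirectSum.induction_on with
        | zero => simp
        | of j x =>
          rw [DirectSum.coeAddMonoidHom_of, hE j _ (f.map_gr j _ x.2), Finsupp.single_apply,
            DirectSum.coe_of_apply]
          split_ifs <;> simp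
        | add v w hv hw => simp [hv, hw]
      have hv : ∀ i, i ≠ d → v i = 0 := fun i hi => by
        have h := key v i
        rw [hE d _ hy, Finsupp.single_eq_of_ne hi, ← map_zero f.toLin] at h
        exact Subtype.ext (hf.1 h).symm
      have hv' : v = DirectSum.of (fun d => M.gr d) d (v d) := by
        refine DFinsupp.ext fun i => ?_
        by_cases hi : i = d
        · subst hi
          rw [DirectSum.of_eq_same]
        · rw [hv i hi, DirectSum.of_eq_of_ne _ _ _ hi]
      rw [hv', DirectSum.coeAddMonoidHom_of]
      exact (v d).2)

/-- The homomorphism from a direct sum given by homomorphisms on the summands. -/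
def prodDesc {M N K : A1Mod} (f : M ⟶ K) (g : N ⟶ K) : M.prod N ⟶ K where
  toLin := LinearMap.coprod f.toLin g.toLin
  map_act a x := by
    change f.toLin (M.act a x.1) + g.toLin (N.act a x.2) = K.act a (f.toLin x.1 + g.toLin x.2)
    rw [f.map_act, g.map_act, map_add]
  map_gr d x hx := (K.gr d).add_mem (f.map_gr d _ hx.1) (g.map_gr d _ hx.2)

/-- A projective summand does not change the stable class. -/
theorem stablyIso_prod (M : A1Mod) {P : A1Mod} (hP : P.IsProjective) :
    StablyIso (M.prod P) M := by
  let p : M.prod P ⟶ M :=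
    ⟨LinearMap.fst M2 M.carrier P.carrier, fun _ _ => rfl, fun _ _ h => h.1⟩
  let i : M ⟶ M.prod P :=
    ⟨LinearMap.inl M2 M.carrier P.carrier, fun a x => Prod.ext rfl (map_zero (P.act a)).symm,
      fun d x h => ⟨h, AddSubgroup.zero_mem _⟩⟩
  let q : M.prod P ⟶ P :=
    ⟨LinearMap.snd M2 M.carrier P.carrier, fun _ _ => rfl, fun _ _ h => h.2⟩
  let j : P ⟶ M.prod P :=
    ⟨LinearMap.inr M2 M.carrier P.carrier, fun a x => Prod.ext (map_zero (M.act a)).symm rfl,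
      fun d x h => ⟨AddSubgroup.zero_mem _, h⟩⟩
  refine ⟨⟨toStab.map p, toStab.map i, ?_, ?_⟩⟩
  · rw [← Functor.map_comp, ← CategoryTheory.Functor.map_id]
    refine CategoryTheory.Quotient.sound _ (Congruence.equivalence.symm ⟨P, q, j, hP, ?_⟩)
    refine LinearMap.ext fun x => ?_
    obtain ⟨x, y⟩ := x
    change ((x, y) - (x, 0) : M.carrier × P.carrier) = (0, y)
    simp
  · rw [← Functor.map_comp, ← CategoryTheory.Functor.map_id]
    exact congrArg toStab.map (hom_ext rfl)

/-! ### The dual of the joker -/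

/-- `Sq¹` on the dual joker, in the basis `a, Sq¹a, Sq²a, Sq²Sq¹a, Sq¹Sq²Sq¹a`. -/
def dualJokerSq1 : Module.End M2 (Fin 5 → M2) where
  toFun v := ![0, v 0, 0, 0, v 3]
  map_add' v w := by ext1 i; fin_cases i <;> simp
  map_smul' r v := by ext1 i; fin_cases i <;> simp

/-- `Sq²` on the dual joker, in the basis `a, Sq¹a, Sq²a, Sq²Sq¹a, Sq¹Sq²Sq¹a`. -/
def dualJokerSq2 : Module.End M2 (Fin 5 → M2) where
  toFun v := ![0, 0, v 0, v 1, tau * v 2]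
  map_add' v w := by ext1 i; fin_cases i <;> simp [mul_add]
  map_smul' r v := by ext1 i; fin_cases i <;> simp [mul_left_comm]

/-- The action of `𝒜(1)` on the dual joker. -/
def dualJokerAct : A1 →ₐ[M2] Module.End M2 (Fin 5 → M2) :=
  A1.lift dualJokerSq1 dualJokerSq2
    (by refine LinearMap.ext fun v => funext fun i => ?_; fin_cases i <;> simp [dualJokerSq1])
    (by refine LinearMap.ext fun v => funext fun i => ?_
        fin_cases i <;> simp [dualJokerSq1, dualJokerSq2])
    (by refine LinearMap.ext fun v => funext fun i => ?_
        fin_cases i <;> simp [dualJokerSq1, dualJokerSq2])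

theorem dualJokerAct_sq1 (v : Fin 5 → M2) : dualJokerAct sq1 v = ![0, v 0, 0, 0, v 3] := by
  rw [dualJokerAct, A1.lift_sq1]; rfl

theorem dualJokerAct_sq2 (v : Fin 5 → M2) :
    dualJokerAct sq2 v = ![0, 0, v 0, v 1, tau * v 2] := by
  rw [dualJokerAct, A1.lift_sq2]; rfl

/-- The `M2`-linear dual of the joker. It is cyclic, generated by an element `a` of bidegree
`(-4,-1)` dual to `Sq²y`, and is written in its basis `a, Sq¹a, Sq²a, Sq²Sq¹a, Sq¹Sq²Sq¹a`, which
is dual to `Sq²y, Sq²Sq¹x, y, Sq¹x, x`. -/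
def dualJoker : A1Mod where
  carrier := Fin 5 → M2
  act := dualJokerAct
  gr := freeGr ![(-4, -1), (-3, -1), (-2, 0), (-1, 0), (0, 0)]
  isInternal := freeGr_isInternal _
  tau_mem d v hv i k hk := by
    obtain ⟨l, rfl, hl⟩ := coeff_tau_smul hk
    rw [← hv i l hl]
    push_cast
    rw [add_assoc]
    simp
  sq1_mem d v hv i k hk := by
    rw [dualJokerAct_sq1] at hk
    fin_cases i
    · simp at hk
    · rw [← hv 0 k hk]; ext <;> simp
    · simp at hk
    · simp at hk
    · rw [← hv 3 k hk]; ext <;> simp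
  sq2_mem d v hv i k hk := by
    rw [dualJokerAct_sq2] at hk
    fin_cases i
    · simp at hk
    · simp at hk
    · rw [← hv 0 k hk]; ext <;> simp
    · rw [← hv 1 k hk]; ext <;> simp
    · obtain ⟨l, rfl, hl⟩ := coeff_tau_smul hk
      rw [← hv 2 l hl]; ext <;> simp
  finite := inferInstance
  free := inferInstance

theorem single_mem_freeGr {ι : Type} [DecidableEq ι] (deg : ι → ℤ × ℤ) (i : ι) :
    (Pi.single i 1 : ι → M2) ∈ freeGr deg (deg i) := by
  intro j k hk
  by_cases hj : j = i
  · subst hj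
    rw [Pi.single_eq_same, Polynomial.coeff_one] at hk
    split_ifs at hk with h
    · subst h; ext <;> simp
    · exact (hk rfl).elim
  · rw [Pi.single_eq_of_ne hj] at hk
    exact (hk (Polynomial.coeff_zero k)).elim

/-! ### The tensor product of the joker and its dual -/

/-- The elements of the tensor product of the two bases. -/
def tensorBasis (i j : Fin 5) : (joker.tensor dualJoker).carrier :=
  (Pi.single i 1 : Fin 5 → M2) ⊗ₜ[M2] (Pi.single j 1 : Fin 5 → M2)

theorem tensorBasis_mem {d : ℤ × ℤ} (i j : Fin 5)
    (h : (![(0, 0), (1, 0), (2, 0), (3, 1), (4, 1)] : Fin 5 → ℤ × ℤ) i +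
      (![(-4, -1), (-3, -1), (-2, 0), (-1, 0), (0, 0)] : Fin 5 → ℤ × ℤ) j = d) :
    tensorBasis i j ∈ (joker.tensor dualJoker).gr d :=
  tmul_mem_tensorGr (M := joker) (N := dualJoker) h (single_mem_freeGr _ i) (single_mem_freeGr _ j)

theorem tensorBasis_span :
    Submodule.span M2 (Set.range fun p : Fin 5 × Fin 5 => tensorBasis p.1 p.2) = ⊤ := by
  refine Eq.trans ?_ ((Pi.basisFun M2 (Fin 5)).tensorProduct (Pi.basisFun M2 (Fin 5))).span_eq
  refine congrArg (fun f => Submodule.span M2 (Set.range f)) (funext fun p => ?_)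
  rw [Module.Basis.tensorProduct_apply', Pi.basisFun_apply, Pi.basisFun_apply]
  rfl

theorem jokerAct_sq1_single (i : Fin 5) : jokerAct sq1 (Pi.single i 1) =
    (![Pi.single 1 1, 0, 0, Pi.single 4 1, 0] : Fin 5 → Fin 5 → M2) i := by
  rw [jokerAct_sq1]
  refine funext fun j => ?_
  fin_cases i <;> fin_cases j <;> simp

theorem jokerAct_sq2_single (i : Fin 5) : jokerAct sq2 (Pi.single i 1) =
    (![tau • Pi.single 2 1, Pi.single 3 1, Pi.single 4 1, 0, 0] : Fin 5 → Fin 5 → M2) i := by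
  rw [jokerAct_sq2]
  refine funext fun j => ?_
  fin_cases i <;> fin_cases j <;> simp

theorem dualJokerAct_sq1_single (i : Fin 5) : dualJokerAct sq1 (Pi.single i 1) =
    (![Pi.single 1 1, 0, 0, Pi.single 4 1, 0] : Fin 5 → Fin 5 → M2) i := by
  rw [dualJokerAct_sq1]
  refine funext fun j => ?_
  fin_cases i <;> fin_cases j <;> simp

theorem dualJokerAct_sq2_single (i : Fin 5) : dualJokerAct sq2 (Pi.single i 1) =
    (![Pi.single 2 1, Pi.single 3 1, tau • Pi.single 4 1, 0, 0] : Fin 5 → Fin 5 → M2) i := by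
  rw [dualJokerAct_sq2]
  refine funext fun j => ?_
  fin_cases i <;> fin_cases j <;> simp

theorem act_sq1_tensorBasis (i j : Fin 5) :
    (joker.tensor dualJoker).act sq1 (tensorBasis i j) =
      (![tensorBasis 1 j, 0, 0, tensorBasis 4 j, 0] : Fin 5 → (joker.tensor dualJoker).carrier) i +
      (![tensorBasis i 1, 0, 0, tensorBasis i 4, 0] :
        Fin 5 → (joker.tensor dualJoker).carrier) j := by
  refine (tensorAct_sq1 jokerAct dualJokerAct _ _).trans ?_
  rw [jokerAct_sq1_single, dualJokerAct_sq1_single]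
  refine congrArg₂ (· + ·) ?_ ?_
  · fin_cases i <;> first | rfl | exact TensorProduct.zero_tmul _ _
  · fin_cases j <;> first | rfl | exact TensorProduct.tmul_zero _ _

theorem act_sq2_tensorBasis (i j : Fin 5) :
    (joker.tensor dualJoker).act sq2 (tensorBasis i j) =
      (![tau • tensorBasis 2 j, tensorBasis 3 j, tensorBasis 4 j, 0, 0] :
        Fin 5 → (joker.tensor dualJoker).carrier) i +
      (![tensorBasis i 2, tensorBasis i 3, tau • tensorBasis i 4, 0, 0] :
        Fin 5 → (joker.tensor dualJoker).carrier) j +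
      tau • (![(![tensorBasis 1 1, 0, 0, tensorBasis 1 4, 0] :
          Fin 5 → (joker.tensor dualJoker).carrier) j, 0, 0,
        (![tensorBasis 4 1, 0, 0, tensorBasis 4 4, 0] :
          Fin 5 → (joker.tensor dualJoker).carrier) j, 0] :
        Fin 5 → (joker.tensor dualJoker).carrier) i := by
  refine (tensorAct_sq2 jokerAct dualJokerAct _ _).trans ?_
  rw [jokerAct_sq2_single, dualJokerAct_sq2_single, jokerAct_sq1_single, dualJokerAct_sq1_single]
  refine congrArg₂ (· + ·) (congrArg₂ (· + ·) ?_ ?_) (congrArg (tau • ·) ?_)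
  · fin_cases i <;> first | rfl | exact TensorProduct.zero_tmul _ _
  · fin_cases j
    exacts [rfl, rfl, TensorProduct.tmul_smul tau (Pi.single i 1 : Fin 5 → M2)
      (Pi.single 4 1 : Fin 5 → M2), TensorProduct.tmul_zero _ _,
      TensorProduct.tmul_zero _ _]
  · fin_cases i <;> fin_cases j <;>
      first | rfl | exact TensorProduct.zero_tmul _ _ | exact TensorProduct.tmul_zero _ _

/-- The canonical invariant element of the tensor product of the joker and its dual. -/
def coevElement : (joker.tensor dualJoker).carrier :=
  tensorBasis 0 4 + tensorBasis 1 3 + tensorBasis 2 2 + tensorBasis 3 1 + tensorBasis 4 0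

theorem act_sq1_coevElement : (joker.tensor dualJoker).act sq1 coevElement = 0 := by
  have two (x : (joker.tensor dualJoker).carrier) : x + x = 0 := add_self_M2 x
  simp only [coevElement, map_add, act_sq1_tensorBasis]
  simp
  linear_combination (norm := module) two (tensorBasis 1 4) + two (tensorBasis 4 1)

theorem act_sq2_coevElement : (joker.tensor dualJoker).act sq2 coevElement = 0 := by
  have two (x : (joker.tensor dualJoker).carrier) : x + x = 0 := add_self_M2 x
  simp only [coevElement, map_add, act_sq2_tensorBasis]
  simp
  linear_combination (norm := module) tau • two (tensorBasis 2 4) + two (tensorBasis 3 3) +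
    two (tensorBasis 4 2)

/-- The homomorphism from the unit given by an element of bidegree `0` that `Sq¹` and `Sq²`
annihilate. -/
def ofInvariant {M : A1Mod} (z : M.carrier) (hz : z ∈ M.gr 0) (h1 : M.act sq1 z = 0)
    (h2 : M.act sq2 z = 0) : unit ⟶ M where
  toLin := LinearMap.toSpanSingleton M2 M.carrier z
  map_act := map_act_of_generators (ρ := trivialAct M2) (σ := M.act) _
    (fun p => by simp [h1]) (fun p => by simp [h2])
  map_gr d p hp := smul_unit_mem (add_zero d) hp hz

theorem injective_of_surjective_of_finrank_eq {V W : Type*} [AddCommGroup V] [Module M2 V]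
    [Module.Finite M2 V] [Module.Free M2 V] [AddCommGroup W] [Module M2 W] [Module.Finite M2 W]
    [Module.Free M2 W] (h : Module.finrank M2 V = Module.finrank M2 W) (f : V →ₗ[M2] W)
    (hf : Function.Surjective f) : Function.Injective f := by
  let e := LinearEquiv.ofFinrankEq W V h.symm
  have := OrzechProperty.injective_of_surjective_endomorphism (e.toLinearMap.comp f)
    (e.surjective.comp hf)
  rw [LinearMap.coe_comp] at this
  exact this.of_comp

/-- A submodule of the tensor product of the joker and its dual is everything if it is stable under
`𝒜(1)` and contains the invariant element and the generators `x ⊗ a`, `Sq¹x ⊗ a`, `y ⊗ a` of the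
projective summand. -/
theorem eq_top_of_stable (S : Submodule M2 (joker.tensor dualJoker).carrier)
    (hS1 : ∀ z ∈ S, (joker.tensor dualJoker).act sq1 z ∈ S)
    (hS2 : ∀ z ∈ S, (joker.tensor dualJoker).act sq2 z ∈ S) (hc : coevElement ∈ S)
    (h00 : tensorBasis 0 0 ∈ S) (h10 : tensorBasis 1 0 ∈ S) (h20 : tensorBasis 2 0 ∈ S) :
    S = ⊤ := by
  have two (x : (joker.tensor dualJoker).carrier) : x + x = 0 := add_self_M2 x
  have s1 (i j : Fin 5) (h : tensorBasis i j ∈ S) := by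
    have h' := hS1 _ h
    rw [act_sq1_tensorBasis] at h'
    exact h'
  have s2 (i j : Fin 5) (h : tensorBasis i j ∈ S) := by
    have h' := hS2 _ h
    rw [act_sq2_tensorBasis] at h'
    exact h'
  have t {z : (joker.tensor dualJoker).carrier} (h : z ∈ S) : tau • z ∈ S := S.smul_mem _ h
  have h01 : tensorBasis 0 1 ∈ S := by simpa [S.add_mem_iff_right h10] using s1 0 0 h00
  have h11 : tensorBasis 1 1 ∈ S := by simpa using s1 1 0 h10
  have h21 : tensorBasis 2 1 ∈ S := by simpa using s1 2 0 h20
  have h02 : tensorBasis 0 2 ∈ S := by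
    simpa [S.add_mem_iff_left (t h11), S.add_mem_iff_right (t h20)] using s2 0 0 h00
  have h12 : tensorBasis 1 2 ∈ S := by simpa using s1 0 2 h02
  have h30 : tensorBasis 3 0 ∈ S := by simpa [S.add_mem_iff_left h12] using s2 1 0 h10
  have h03 : tensorBasis 0 3 ∈ S := by
    simpa [S.add_mem_iff_right (t h21)] using s2 0 1 h01
  -- in bidegree `(0,0)`, four differences of the five basis elements are available, and the
  -- invariant element is congruent to each of the five modulo these differences
  have d1 : tensorBasis 3 1 + tensorBasis 1 3 ∈ S := by simpa using s2 1 1 h11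
  have d2 : tensorBasis 1 3 + tensorBasis 0 4 ∈ S := by simpa using s1 0 3 h03
  have d3 : tensorBasis 4 0 + tensorBasis 3 1 ∈ S := by simpa using s1 3 0 h30
  have d4 : tensorBasis 4 0 + tensorBasis 2 2 ∈ S := by simpa using s2 2 0 h20
  have h04 : tensorBasis 0 4 ∈ S := by
    have e : tensorBasis 0 4 = coevElement + (tensorBasis 3 1 + tensorBasis 1 3) +
        (tensorBasis 4 0 + tensorBasis 2 2) := by
      rw [coevElement]
      linear_combination (norm := module) -two (tensorBasis 1 3) - two (tensorBasis 3 1) -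
        two (tensorBasis 2 2) - two (tensorBasis 4 0)
    rw [e]
    exact S.add_mem (S.add_mem hc d1) d4
  have h13 : tensorBasis 1 3 ∈ S := (S.add_mem_iff_left h04).1 d2
  have h31 : tensorBasis 3 1 ∈ S := (S.add_mem_iff_left h13).1 d1
  have h40 : tensorBasis 4 0 ∈ S := (S.add_mem_iff_left h31).1 d3
  have h22 : tensorBasis 2 2 ∈ S := (S.add_mem_iff_right h40).1 d4
  have h14 : tensorBasis 1 4 ∈ S := by simpa using s1 0 4 h04
  have h41 : tensorBasis 4 1 ∈ S := by simpa using s1 4 0 h40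
  have h23 : tensorBasis 2 3 ∈ S := by simpa [S.add_mem_iff_right h41] using s2 2 1 h21
  have h32 : tensorBasis 3 2 ∈ S := by simpa [S.add_mem_iff_left (t h14)] using s2 1 2 h12
  have h24 : tensorBasis 2 4 ∈ S := by simpa using s1 2 3 h23
  have h33 : tensorBasis 3 3 ∈ S := by
    simpa [S.add_mem_iff_left (t h14)] using s2 1 3 h13
  have h42 : tensorBasis 4 2 ∈ S := by simpa using s1 3 2 h32
  have h34 : tensorBasis 3 4 ∈ S := by simpa using s2 1 4 h14
  have h43 : tensorBasis 4 3 ∈ S := by simpa using s2 4 1 h41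
  have h44 : tensorBasis 4 4 ∈ S := by simpa using s1 3 4 h34
  rw [eq_top_iff, ← tensorBasis_span, Submodule.span_le]
  rintro _ ⟨⟨i, j⟩, rfl⟩
  change tensorBasis i j ∈ S
  fin_cases i <;> fin_cases j <;> assumption

/-- The homomorphism `M2 ⊕ 𝒜(1)³ → J ⊗ DJ` given by the invariant element and the elements
`x ⊗ a`, `Sq¹x ⊗ a`, `y ⊗ a`. -/
def splitting :
    unit.prod ((regular (-4, -1)).prod ((regular (-3, -1)).prod (regular (-2, -1)))) ⟶
      joker.tensor dualJoker :=
  prodDesc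
    (ofInvariant coevElement
      (AddSubgroup.add_mem _ (AddSubgroup.add_mem _ (AddSubgroup.add_mem _ (AddSubgroup.add_mem _
        (tensorBasis_mem 0 4 rfl) (tensorBasis_mem 1 3 rfl)) (tensorBasis_mem 2 2 rfl))
        (tensorBasis_mem 3 1 rfl)) (tensorBasis_mem 4 0 rfl))
      act_sq1_coevElement act_sq2_coevElement)
    (prodDesc (ofElement (tensorBasis 0 0) (tensorBasis_mem 0 0 rfl))
      (prodDesc (ofElement (tensorBasis 1 0) (tensorBasis_mem 1 0 rfl))
        (ofElement (tensorBasis 2 0) (tensorBasis_mem 2 0 rfl))))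

theorem splitting_apply (p : M2) (a b c : A1) :
    splitting.toLin (p, a, b, c) = p • coevElement + ((joker.tensor dualJoker).act a
      (tensorBasis 0 0) + ((joker.tensor dualJoker).act b (tensorBasis 1 0) +
        (joker.tensor dualJoker).act c (tensorBasis 2 0))) := rfl

theorem splitting_surjective : Function.Surjective splitting.toLin := by
  rw [← LinearMap.range_eq_top]
  refine eq_top_of_stable _ ?_ ?_ ⟨((1 : M2), (0 : A1), (0 : A1), (0 : A1)), ?_⟩
    ⟨((0 : M2), (1 : A1), (0 : A1), (0 : A1)), ?_⟩ ⟨((0 : M2), (0 : A1), (1 : A1), (0 : A1)), ?_⟩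
    ⟨((0 : M2), (0 : A1), (0 : A1), (1 : A1)), ?_⟩
  · rintro _ ⟨z, rfl⟩
    exact ⟨_, splitting.map_act sq1 z⟩
  · rintro _ ⟨z, rfl⟩
    exact ⟨_, splitting.map_act sq2 z⟩
  all_goals
    refine (splitting_apply _ _ _ _).trans ?_
    simp

theorem splitting_bijective : Function.Bijective splitting.toLin := by
  refine ⟨injective_of_surjective_of_finrank_eq ?_ _ splitting_surjective, splitting_surjective⟩
  have : Module.Free M2 A1 := Module.Free.of_basis monoBasis
  have hA : Module.finrank M2 A1 = 8 := by
    rw [Module.finrank_eq_card_basis monoBasis, Fintype.card_fin]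
  have hl : Module.finrank M2 (M2 × A1 × A1 × A1) = 25 := by
    simp [hA]
  have hr : Module.finrank M2 ((Fin 5 → M2) ⊗[M2] (Fin 5 → M2)) = 25 := by
    simp
  exact hl.trans hr.symm

/-- The tensor product of the joker and its dual is the sum of the unit and a free module of rank
three. -/
theorem joker_isInvertible : joker.IsInvertible :=
  ⟨dualJoker, (StablyIso.of_iso (isoOfBijective splitting splitting_bijective).symm).trans
    (stablyIso_prod unit ((regular_isProjective _).prod
      ((regular_isProjective _).prod (regular_isProjective _))))⟩

end A1Mod

/-! ### Margolis homology modulo `τ` -/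

namespace A1Mod

theorem margolisGr_ne_bot_iff (M : A1Mod) (a : A1) (k : ℤ × ℤ) :
    M.margolisGr a k ≠ ⊥ ↔ ∃ x ∈ M.gr k, (∃ v, M.act a x = tau • v) ∧
      ∀ u v, x ≠ M.act a u + tau • v := by
  have hz (x : M.carrier) : (Submodule.mkQ (LinearMap.range (LinearMap.lsmul M2 M.carrier tau)) x =
      0) ↔ ∃ v, x = tau • v := by
    rw [Submodule.mkQ_apply, Submodule.Quotient.mk_eq_zero, LinearMap.mem_range]
    exact exists_congr fun v => eq_comm
  have hact (x : M.carrier) : M.modTauAct a (Submodule.mkQ _ x) = Submodule.mkQ _ (M.act a x) := rfl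
  rw [Ne, AddSubgroup.eq_bot_iff_forall]
  push Not
  constructor
  · rintro ⟨_, ⟨⟨_, hk⟩, ⟨x, hx, rfl⟩, rfl⟩, h⟩
    refine ⟨x, hx, (hz _).1 ?_, fun u v e => h ?_⟩
    · exact hk
    · refine (Submodule.Quotient.mk_eq_zero _).2 ?_
      refine ⟨Submodule.mkQ _ u, ?_⟩
      change M.modTauAct a (Submodule.mkQ _ u) = Submodule.mkQ _ x
      rw [hact, e, map_add, (hz (tau • v)).2 ⟨v, rfl⟩, add_zero]
  · rintro ⟨x, hx, ⟨v, hv⟩, h⟩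
    refine ⟨_, ⟨⟨Submodule.mkQ _ x, ?_⟩, ⟨x, hx, rfl⟩, rfl⟩, fun h0 => ?_⟩
    · rw [LinearMap.mem_ker, hact, hv, hz]
      exact ⟨v, rfl⟩
    · have h1 := (Submodule.Quotient.mk_eq_zero _).1 h0
      obtain ⟨u, hu⟩ := h1
      obtain ⟨u, rfl⟩ := Submodule.mkQ_surjective _ u
      change M.modTauAct a (Submodule.mkQ _ u) = Submodule.mkQ _ x at hu
      rw [hact, ← sub_eq_zero, ← map_sub, hz] at hu
      obtain ⟨v, hv⟩ := hu
      refine h u (-v) ?_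
      rw [smul_neg, ← hv]
      abel

/-- Modulo `τ`, the operator `D` on the bigraded `M2`-module `V` is a differential that contracts
onto a single class of bidegree `e`: there are a class `w`, a functional `ε` and a homotopy `h` with
`D h + h D + id = ε(·) w` and with `D w = 0`, `ε D = 0`, all of it modulo `τ`, and with `ε w = 1`;
moreover `ε` vanishes modulo `τ` outside bidegree `e`. The homotopy is not required to be
homogeneous. -/
def HasMargolisRetract {V : Type*} [AddCommGroup V] [Module M2 V] (gr : ℤ × ℤ → AddSubgroup V)
    (D : Module.End M2 V) (e : ℤ × ℤ) : Prop :=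
  ∃ (w : V) (ε : V →ₗ[M2] M2) (h : V →ₗ[M2] V),
    w ∈ gr e ∧ (∃ v, D w = tau • v) ∧ ε w = 1 ∧ (∀ x, ∃ r, ε (D x) = tau * r) ∧
    (∀ k, k ≠ e → ∀ x ∈ gr k, ∃ r, ε x = tau * r) ∧
    ∀ x, ∃ v, D (h x) + h (D x) + x = ε x • w + tau • v

theorem HasMargolisRetract.margolisGr_ne_bot_iff {M : A1Mod} {a : A1} {e : ℤ × ℤ}
    (H : HasMargolisRetract M.gr (M.act a) e) (k : ℤ × ℤ) : M.margolisGr a k ≠ ⊥ ↔ k = e := by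
  obtain ⟨w, ε, h, hw, haw, hεw, hεa, hε, hh⟩ := H
  rw [A1Mod.margolisGr_ne_bot_iff]
  constructor
  · rintro ⟨x, hx, ⟨v, hv⟩, hb⟩
    by_contra hk
    obtain ⟨r, hr⟩ := hε k hk x hx
    obtain ⟨v', hv'⟩ := hh x
    refine hb (-h x) (r • w + v' - h v) ?_
    rw [hv, hr, map_smul] at hv'
    rw [map_neg]
    linear_combination (norm := module) hv'
  · rintro rfl
    refine ⟨w, hw, haw, fun u v e => ?_⟩
    obtain ⟨r, hr⟩ := hεa u
    rw [e, map_add, hr, map_smul, smul_eq_mul, ← mul_add] at hεw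
    exact Polynomial.not_isUnit_X (IsUnit.of_mul_eq_one _ hεw)

theorem one_mem_unit_gr : (1 : M2) ∈ unit.gr 0 := by
  intro k hk
  rw [Polynomial.coeff_one] at hk
  split_ifs at hk with h
  · subst h; rfl
  · exact (hk rfl).elim

theorem unit_hasMargolisRetract :
    HasMargolisRetract (V := M2) unit.gr 0 0 := by
  refine ⟨1, LinearMap.id, 0, one_mem_unit_gr, ⟨0, by simp⟩, rfl, fun x => ⟨0, by simp⟩,
    fun k hk x hx => Polynomial.X_dvd_iff.2 ?_, fun x => ⟨0, by simp⟩⟩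
  by_contra h
  exact hk (hx 0 h).symm

/-- The element `a` acts on tensor products as a derivation, up to multiples of `τ`. -/
def IsPrimitiveModTau (a : A1) : Prop :=
  ∀ (M N : A1Mod) (x : M.carrier) (y : N.carrier), ∃ v : M.carrier ⊗[M2] N.carrier,
    tensorAct M.act N.act a (x ⊗ₜ y) = M.act a x ⊗ₜ y + x ⊗ₜ N.act a y + tau • v

theorem isPrimitiveModTau_sq1 : IsPrimitiveModTau sq1 := fun M N x y =>
  ⟨0, by rw [tensorAct_sq1, smul_zero, add_zero]⟩

theorem isPrimitiveModTau_sq2 : IsPrimitiveModTau sq2 := fun M N x y =>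
  ⟨M.act sq1 x ⊗ₜ N.act sq1 y, tensorAct_sq2 _ _ x y⟩

/-- The Künneth theorem for contractions onto one class: if `h`, `h'` contract the factors then
`h ⊗ 1 + ε(·)w ⊗ h'` contracts the tensor product. -/
theorem HasMargolisRetract.tensor {M N : A1Mod} {a : A1} {e e' : ℤ × ℤ} (ha : IsPrimitiveModTau a)
    (H : HasMargolisRetract M.gr (M.act a) e) (H' : HasMargolisRetract N.gr (N.act a) e') :
    HasMargolisRetract (tensorGr M N) (tensorAct M.act N.act a) (e + e') := by
  obtain ⟨w, ε, h, hw, ⟨v₁, hv₁⟩, hεw, hεa, hε, hh⟩ := H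
  obtain ⟨w', ε', h', hw', ⟨v₂, hv₂⟩, hεw', hεa', hε', hh'⟩ := H'
  let ε₂ : M.carrier ⊗[M2] N.carrier →ₗ[M2] M2 :=
    (TensorProduct.lid M2 M2).toLinearMap.comp (TensorProduct.map ε ε')
  have hε₂ (x y) : ε₂ (x ⊗ₜ y) = ε x * ε' y := rfl
  let h₂ : M.carrier ⊗[M2] N.carrier →ₗ[M2] M.carrier ⊗[M2] N.carrier :=
    TensorProduct.map h LinearMap.id + TensorProduct.map (ε.smulRight w) h'
  have hh₂ (x y) : h₂ (x ⊗ₜ y) = h x ⊗ₜ y + (ε x • w) ⊗ₜ h' y := rfl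
  let D : Module.End M2 (M.carrier ⊗[M2] N.carrier) := tensorAct M.act N.act a
  have hD (x y) : ∃ v, D (x ⊗ₜ y) = M.act a x ⊗ₜ y + x ⊗ₜ N.act a y + tau • v := ha M N x y
  refine ⟨w ⊗ₜ[M2] w', ε₂, h₂, tmul_mem_tensorGr rfl hw hw', ?_, ?_,
    fun z => ?_, fun k hk => ?_, fun z => ?_⟩
  · obtain ⟨v, hv⟩ := hD w w'
    refine ⟨v₁ ⊗ₜ w' + w ⊗ₜ v₂ + v, hv.trans ?_⟩
    rw [hv₁, hv₂, ← TensorProduct.smul_tmul', TensorProduct.tmul_smul, smul_add, smul_add]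
  · rw [hε₂, hεw, hεw', one_mul]
  · change ∃ r, ε₂ (D z) = tau * r
    induction z using TensorProduct.induction_on with
    | zero => exact ⟨0, by simp⟩
    | tmul x y =>
      obtain ⟨v, hv⟩ := hD x y
      obtain ⟨r, hr⟩ := hεa x
      obtain ⟨r', hr'⟩ := hεa' y
      refine ⟨r * ε' y + ε x * r' + ε₂ v, ?_⟩
      rw [hv, map_add, map_add, hε₂, hε₂, hr, hr', map_smul, smul_eq_mul]
      ring
    | add y z hy hz =>
      obtain ⟨r, hr⟩ := hy
      obtain ⟨s, hs⟩ := hz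
      exact ⟨r + s, by rw [map_add, map_add, hr, hs, mul_add]⟩
  · have hdvd := tensorGr_map (M := M) (N := N) ε₂.toAddMonoidHom k
      (Ideal.span {tau}).toAddSubgroup (fun i j hij x hx y hy => by
        change ε x * ε' y ∈ Ideal.span {tau}
        rw [Ideal.mem_span_singleton]
        by_cases hi : i = e
        · by_cases hj : j = e'
          · subst hi hj; exact (hk hij.symm).elim
          · exact Dvd.dvd.mul_left (hε' j hj y hy) _
        · exact Dvd.dvd.mul_right (hε i hi x hx) _)
    intro z hz
    exact Ideal.mem_span_singleton.1 (hdvd z hz)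
  · change ∃ v, D (h₂ z) + h₂ (D z) + z = ε₂ z • (w ⊗ₜ w') + tau • v
    induction z using TensorProduct.induction_on with
    | zero => exact ⟨0, by simp⟩
    | tmul x y =>
      obtain ⟨t₁, ht₁⟩ := hD (h x) y
      obtain ⟨t₂, ht₂⟩ := hD w (h' y)
      obtain ⟨t₃, ht₃⟩ := hD x y
      obtain ⟨u, hu⟩ := hh x
      obtain ⟨u', hu'⟩ := hh' y
      obtain ⟨r, hr⟩ := hεa x
      have two (z : M.carrier ⊗[M2] N.carrier) : z + z = 0 := add_self_M2 z
      have e₁ := congrArg (· ⊗ₜ[M2] y) hu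
      have e₂ := congrArg (w ⊗ₜ[M2] ·) hu'
      simp only [TensorProduct.add_tmul, TensorProduct.tmul_add, TensorProduct.tmul_smul,
        ← TensorProduct.smul_tmul'] at e₁ e₂
      refine ⟨t₁ + ε x • t₂ + h₂ t₃ + ε x • (v₁ ⊗ₜ h' y) + r • (w ⊗ₜ h' y) + u ⊗ₜ y +
        ε x • (w ⊗ₜ u'), ?_⟩
      rw [hh₂, map_add, ht₁, ← TensorProduct.smul_tmul', map_smul, ht₂, ht₃, map_add, map_add,
        map_smul, hh₂, hh₂, hr, hv₁, hε₂]
      simp only [← TensorProduct.smul_tmul']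
      linear_combination (norm := module) e₁ + ε x • e₂ + two (h x ⊗ₜ N.act a y)
    | add y z hy hz =>
      obtain ⟨r, hr⟩ := hy
      obtain ⟨s, hs⟩ := hz
      refine ⟨r + s, ?_⟩
      rw [map_add, map_add, map_add, map_add, map_add]
      linear_combination (norm := module) hr + hs

/-- Modulo `τ`, the `Sq²`-homology of the joker is spanned by `x`: the other basis elements are
paired by `Sq²Sq¹x = Sq²(Sq¹x)` and `Sq²y = Sq²(y)`. -/
theorem joker_hasMargolisRetract_sq2 : HasMargolisRetract joker.gr (joker.act sq2) 0 := by
  change HasMargolisRetract (V := Fin 5 → M2) joker.gr (jokerAct sq2) 0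
  let h : (Fin 5 → M2) →ₗ[M2] (Fin 5 → M2) :=
    { toFun := fun v => ![0, v 3, v 4, 0, 0]
      map_add' := fun v w => by ext1 i; fin_cases i <;> simp
      map_smul' := fun r v => by ext1 i; fin_cases i <;> simp }
  have hh (v) : h v = ![0, v 3, v 4, 0, 0] := rfl
  have two (p : M2) : p + p = 0 := add_self_M2 p
  refine ⟨jokerX, LinearMap.proj 0, h, jokerX_mem, ⟨jokerY, ?_⟩, ?_,
    fun v => ⟨0, ?_⟩, fun k hk v hv => ?_, fun v => ⟨0, ?_⟩⟩
  · exact joker_relations.1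
  · simp [jokerX]
  · rw [jokerAct_sq2]
    simp
  · refine Polynomial.X_dvd_iff.2 ?_
    by_contra h
    exact hk (hv 0 0 h).symm
  · rw [jokerAct_sq2, jokerAct_sq2, hh, hh]
    refine funext fun i => ?_
    fin_cases i <;> simp [two, jokerX]

/-- The `Sq¹`-homology of the joker is spanned by `y`: the other basis elements are paired by `Sq¹x`
and `Sq²y = Sq¹(Sq²Sq¹x)`. -/
theorem joker_hasMargolisRetract_sq1 : HasMargolisRetract joker.gr (joker.act sq1) (2, 0) := by
  change HasMargolisRetract (V := Fin 5 → M2) joker.gr (jokerAct sq1) (2, 0)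
  let h : (Fin 5 → M2) →ₗ[M2] (Fin 5 → M2) :=
    { toFun := fun v => ![v 1, 0, 0, v 4, 0]
      map_add' := fun v w => by ext1 i; fin_cases i <;> simp
      map_smul' := fun r v => by ext1 i; fin_cases i <;> simp }
  have hh (v) : h v = ![v 1, 0, 0, v 4, 0] := rfl
  have two (p : M2) : p + p = 0 := add_self_M2 p
  refine ⟨jokerY, LinearMap.proj 2, h, jokerY_mem, ⟨0, ?_⟩, ?_,
    fun v => ⟨0, ?_⟩, fun k hk v hv => ?_, fun v => ⟨0, ?_⟩⟩
  · rw [smul_zero]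
    exact joker_relations.2.2
  · simp [jokerY]
  · rw [jokerAct_sq1]
    simp
  · refine Polynomial.X_dvd_iff.2 ?_
    by_contra h
    exact hk (hv 2 0 h).symm
  · rw [jokerAct_sq1, jokerAct_sq1, hh, hh]
    refine funext fun i => ?_
    fin_cases i <;> simp [two, jokerY]

theorem HasMargolisRetract.tensorPow {M : A1Mod} {a : A1} {e : ℤ × ℤ} (ha : IsPrimitiveModTau a)
    (h0 : trivialAct M2 a = 0) (H : HasMargolisRetract M.gr (M.act a) e) (n : ℕ) :
    HasMargolisRetract (M.tensorPow n).gr ((M.tensorPow n).act a) (n • e) := by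
  induction n with
  | zero => 
    rw [zero_nsmul]
    change HasMargolisRetract (V := M2) unit.gr (trivialAct M2 a) 0
    rw [h0]
    exact unit_hasMargolisRetract
  | succ n ih => rw [succ_nsmul]; exact ih.tensor ha H

theorem joker_tensorPow_sq1 (n : ℕ) :
    HasMargolisRetract (joker.tensorPow n).gr ((joker.tensorPow n).act sq1) (n • (2, 0)) :=
  joker_hasMargolisRetract_sq1.tensorPow isPrimitiveModTau_sq1 (LinearMap.ext trivialAct_sq1) n

theorem joker_tensorPow_sq2 (n : ℕ) :
    HasMargolisRetract (joker.tensorPow n).gr ((joker.tensorPow n).act sq2) 0 := by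
  have h := joker_hasMargolisRetract_sq2.tensorPow isPrimitiveModTau_sq2
    (LinearMap.ext trivialAct_sq2) n
  rwa [nsmul_zero] at h

/-! ### Stable invariance of the bidegree -/

/-- A module with a one-dimensional `Sq¹`-homology modulo `τ` is stably equivalent to the unit only
if this homology lies in bidegree `0`. -/
theorem HasMargolisRetract.eq_zero_of_stablyIso {M : A1Mod} {e : ℤ × ℤ}
    (H : HasMargolisRetract M.gr (M.act sq1) e) (hM : StablyIso M unit) : e = 0 := by
  by_contra he
  obtain ⟨i⟩ := hM
  obtain ⟨f, hf⟩ := toStab.map_surjective i.hom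
  obtain ⟨g, hg⟩ := toStab.map_surjective i.inv
  have hgf : toStab.map (g ≫ f) = toStab.map (𝟙 unit) := by
    rw [Functor.map_comp, hf, hg, i.inv_hom_id, CategoryTheory.Functor.map_id]
  obtain ⟨P, s, t, hP, hst⟩ := (CategoryTheory.Quotient.functor_map_eq_iff _ _ _).1 hgf
  have hact : ∀ p : unit.carrier, unit.act sq1 p = 0 := fun p => trivialAct_sq1 p
  obtain ⟨o, ho⟩ : ∃ o : unit.carrier, o = (1 : M2) := ⟨_, rfl⟩
  have h1 : o ∈ unit.gr 0 := ho ▸ one_mem_unit_gr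
  -- `g 1` is a cycle of the wrong bidegree, so it is a boundary modulo `τ`
  obtain ⟨w, ε, h, hw, haw, hεw, hεa, hε, hh⟩ := H
  obtain ⟨r, hr⟩ := hε 0 (Ne.symm he) _ (g.map_gr 0 _ h1)
  obtain ⟨v, hv⟩ := hh (g.toLin o)
  rw [← g.map_act, hact, map_zero, map_zero, add_zero, hr] at hv
  have hfg : f.toLin (g.toLin o) = tau • f.toLin (r • w + v) := by
    have := congrArg f.toLin hv
    rw [map_add, f.map_act, hact, zero_add] at this
    rw [this, ← map_smul, smul_add, mul_smul]
  -- `s 1` is a boundary, and boundaries vanish in the unit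
  obtain ⟨q, hq⟩ := hP.exists_sq1 (p := s.toLin o) (by rw [← s.map_act, hact, map_zero])
  have hts : t.toLin (s.toLin o) = 0 := by rw [← hq, t.map_act, hact]
  have key : f.toLin (g.toLin o) - o = t.toLin (s.toLin o) := LinearMap.congr_fun hst o
  rw [hts, hfg, ho] at key
  exact Polynomial.not_isUnit_X (IsUnit.of_mul_eq_one _ (sub_eq_zero.1 key))

end A1Mod

end

end MotivicA1

theorem mainTheorem2 :
    -- `J` is invertible, and its class in the Picard group of `𝒜(1)` has infinite order
    (∃ hJ : MotivicA1.A1Mod.IsInvertible MotivicA1.A1Mod.joker,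
      ¬ IsOfFinOrder (MotivicA1.Pic.mk MotivicA1.A1Mod.joker hJ)) ∧
    -- for `n ≥ 1` the `Sq²`-homology and the `Q₀`-homology (`Q₀ = Sq¹`) of `J^{⊗n}/τ` are each
    -- concentrated and nonzero in one bidegree, and these two bidegrees are different
    (∀ n : ℕ, 1 ≤ n → ∃ d e : ℤ × ℤ, d ≠ e ∧
      (∀ k : ℤ × ℤ, MotivicA1.A1Mod.margolisGr
        (MotivicA1.A1Mod.tensorPow MotivicA1.A1Mod.joker n) MotivicA1.A1.sq2 k ≠ ⊥ ↔ k = d) ∧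
      (∀ k : ℤ × ℤ, MotivicA1.A1Mod.margolisGr
        (MotivicA1.A1Mod.tensorPow MotivicA1.A1Mod.joker n) MotivicA1.A1.sq1 k ≠ ⊥ ↔ k = e)) := by
  have hne (n : ℕ) (hn : 1 ≤ n) : n • ((2, 0) : ℤ × ℤ) ≠ 0 := fun h => by
    have := congrArg Prod.fst h
    simp at this
    omega
  refine ⟨⟨MotivicA1.A1Mod.joker_isInvertible, fun h => ?_⟩, fun n hn =>
    ⟨0, n • (2, 0), (hne n hn).symm,
      (MotivicA1.A1Mod.joker_tensorPow_sq2 n).margolisGr_ne_bot_iff,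
      (MotivicA1.A1Mod.joker_tensorPow_sq1 n).margolisGr_ne_bot_iff⟩⟩
  obtain ⟨n, hn, h⟩ := isOfFinOrder_iff_pow_eq_one.1 h
  have h' := congrArg Units.val h
  rw [Units.val_pow_eq_pow_val, Units.val_one, MotivicA1.Pic.val_mk,
    ← MotivicA1.StabClass.mk_tensorPow, ← MotivicA1.StabClass.mk_unit,
    MotivicA1.StabClass.mk_eq_mk] at h'
  exact hne n hn ((MotivicA1.A1Mod.joker_tensorPow_sq1 n).eq_zero_of_stablyIso h')
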